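/- Let $(\Omega,\mathcal G,\mathbb P)$ be a probability space, $m\ge 1$, $\mathbb X\subseteq\mathbb R$, and let $X^1,\dots,X^m\in\mathcal L^2$ be $\mathbb X$-valued random variables with laws $\nu^1,\dots,\nu^m$. For $\alpha=1,\dots,m$ and $i=1,\dots,n(\alpha)$ let $\sigma^\alpha_i>0$, let $\beta^{\alpha,(i)}$ be a continuous standard Brownian bridge on $[0,1]$, and set $\xi^{\alpha,(i)}_t=tX^\alpha+\sigma^\alpha_i\beta^{\alpha,(i)}_t$. Let $\tilde J^\alpha=(\tilde J^{\alpha,(i)}_t)_{t\in[0,1],\,i\le n(\alpha)}$ be a càdlàg process with values in $\{0,1\}^{n(\alpha)}$ (so it has finitely many switching times), and let $J^\alpha_t$ be the diagonal matrix with diagonal $\tilde J^\alpha_t$. All the factors $X^\alpha$, all the bridges $\beta^{\alpha,(i)}$ and all the processes $\tilde J^\alpha$ are mutually independent. Let $\mathcal H_t$ be the $\sigma$-algebra generated by $J^\alpha_u\boldsymbol\xi^\alpha_u$ and $J^\alpha_u$ for $0\le u\le t$, $\alpha=1,\dots,m$, and by $\boldsymbol X\mathbf 1_{\{t=1\}}$,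 where $\boldsymbol X=(X^1,\dots,X^m)$; the statement holds both for this $\mathcal H_t$ and for its right-continuous completed version. Put $h(x,y,t,\sigma)=\exp\{(xy-tx^2/2)/(\sigma^2(1-t))\}$ for $\sigma>0$ and $h(x,y,t,0)=1$. Let $\mathcal J^\alpha_t=\{i:\tilde J^{\alpha,(i)}_t=1\}$ be the set of active sources, and let $\tau^{\alpha,(i)}_t=0\vee\sup\{u\in[0,t]:\tilde J^{\alpha,(i)}_u=1\}$. Put $$\hat\sigma^\alpha_t=\Big(\sum_{i\in\mathcal J^\alpha_t}(\sigma^\alpha_i)^{-2}\Big)^{-1/2},\qquad \hat\xi^\alpha_t=(\hat\sigma^\alpha_t)^2\sum_{i\in\mathcal J^\alpha_t}(\sigma^\alpha_i)^{-2}\,\xi^{\alpha,(i)}_t,$$ both being $0$ if $\mathcal J^\alpha_t=\emptyset$, and let $\eta^\alpha_t$ be the random function on $\mathbb X$ $$\eta^\alpha_t(x)=\prod_{i\notin\mathcal J^\alpha_t}h\big(x,\ \xi^{\alpha,(i)}(\tau^{\alpha,(i)}_t),\ \tau^{\alpha,(i)}_t,\ \sigma^\alpha_i\big).$$ Then for every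 $t\in[0,1)$ the conditional law of $\boldsymbol X$ given $\mathcal H_t$ is the product of the factorwise conditional laws, $$\mathbb P[\boldsymbol X\in d\boldsymbol x\mid\mathcal H_t]=\prod_{\alpha=1}^m\mathbb P\big[X^\alpha\in dx^\alpha\mid\hat\xi^\alpha_t,\hat\sigma^\alpha_t,\eta^\alpha_t\big],$$ and almost surely, for each $\alpha$, $$\mathbb P\big[X^\alpha\in dx\mid\hat\xi^\alpha_t,\hat\sigma^\alpha_t,\eta^\alpha_t\big]=\frac{h(x,\hat\xi^\alpha_t,t,\hat\sigma^\alpha_t)\,\eta^\alpha_t(x)\,\nu^\alpha(dx)}{\int_{\mathbb X}h(y,\hat\xi^\alpha_t,t,\hat\sigma^\alpha_t)\,\eta^\alpha_t(y)\,\nu^\alpha(dy)}.$$ Moreover, for every $\alpha$ for which $\hat\sigma^\alpha_t$ is almost surely equal to a measurable function of $(\hat\xi^\alpha_t,\eta^\alpha_t)$, the $\alpha$-th factor equals $\mathbb P[X^\alpha\in dx\mid\hat\xi^\alpha_t,\eta^\alpha_t]$ almost surely. -/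

import Mathlib

open MeasureTheory ProbabilityTheory Set Filter Topology
open scoped unitInterval

noncomputable section

/-- A standard Brownian bridge on `[0,1]`: a Gaussian process with mean zero, covariance
`min s t - s t`, and continuous sample paths. -/
structure IsBrownianBridge {Ω : Type*} [MeasurableSpace Ω] (β : I → Ω → ℝ) (P : Measure Ω) :
    Prop where
  measurable : ∀ t, Measurable (β t)
  gaussian : IsGaussianProcess β P
  mean_zero : ∀ t, ∫ ω, β t ω ∂P = 0
  cov_eq : ∀ s t : I, covariance (β s) (β t) P = min (s : ℝ) (t : ℝ) - (s : ℝ) * (t : ℝ)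
  continuous_paths : ∀ ω, Continuous fun t => β t ω

/-- A path on `[0,1]` that is right-continuous with left limits. -/
def IsCadlagPath {E : Type*} [TopologicalSpace E] (f : I → E) : Prop :=
  ∀ t, ContinuousWithinAt f (Ici t) t ∧ ∃ l, Tendsto f (𝓝[<] t) (𝓝 l)

/-- The basic σ-algebras carried by the model: one for each factor `X α`, one for each
bridge path `β α i`, one for each switching path `J α`. -/
def sourceSigma {Ω : Type*} {m : ℕ} {n : Fin m → ℕ} (X : Fin m → Ω → ℝ)
    (β : ∀ α, Fin (n α) → I → Ω → ℝ) (J : ∀ α, I → Ω → Fin (n α) → ℝ) :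
    (Fin m ⊕ ((α : Fin m) × Fin (n α)) ⊕ Fin m) → MeasurableSpace Ω
  | .inl α => MeasurableSpace.comap (X α) inferInstance
  | .inr (.inl ⟨α, i⟩) => MeasurableSpace.comap (fun ω (t : I) => β α i t ω) inferInstance
  | .inr (.inr α) => MeasurableSpace.comap (fun ω (t : I) => J α t ω) inferInstance

/-- The multi-factor model of modulated information on `[0,1]`.
`X α` are the factors, with values in `𝕏 ⊆ ℝ`; `vol α i` the noise levels; `β α i` the bridges;
`J α` the `{0,1}^{n α}`-valued càdlàg switching process. (A càdlàg `{0,1}`-valued path on the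
compact interval `[0,1]` is the same thing as an initial state and a finite set of switching
times, so `J α` carries exactly the data of a point field with finitely many points.) -/
structure InfoModel {Ω : Type*} [MeasurableSpace Ω] (P : Measure Ω) (m : ℕ) (n : Fin m → ℕ)
    (𝕏 : Set ℝ) where
  X : Fin m → Ω → ℝ
  vol : ∀ α, Fin (n α) → ℝ
  β : ∀ α, Fin (n α) → I → Ω → ℝ
  J : ∀ α, I → Ω → Fin (n α) → ℝ
  X_measurable : ∀ α, Measurable (X α)
  X_memLp : ∀ α, MemLp (X α) 2 P
  X_mem : ∀ α ω, X α ω ∈ 𝕏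
  vol_pos : ∀ α i, 0 < vol α i
  bridge : ∀ α i, IsBrownianBridge (β α i) P
  J_measurable : ∀ α t, Measurable (J α t)
  J_values : ∀ α t ω i, J α t ω i = 0 ∨ J α t ω i = 1
  J_cadlag : ∀ α ω, IsCadlagPath fun t => J α t ω
  /-- The factors, the bridges and the switching processes are all mutually independent. -/
  indep : iIndep (sourceSigma X β J) P

/-- The Gaussian function `exp ((x y - t x² / 2) / (s² (1 - t)))`, with the convention that it is
`1` when `s = 0` (used only when no source is active: an empty product is `1`). -/
def gaussH (x y t s : ℝ) : ℝ :=
  if s = 0 then 1 else Real.exp ((x * y - t * x ^ 2 / 2) / (s ^ 2 * (1 - t)))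

namespace InfoModel

variable {Ω : Type*} [MeasurableSpace Ω] {P : Measure Ω} {m : ℕ} {n : Fin m → ℕ} {𝕏 : Set ℝ}
  (M : InfoModel P m n 𝕏)

/-- The vector `(X^1, …, X^m)`. -/
def vecX (ω : Ω) : Fin m → ℝ := fun α => M.X α ω

/-- The law `ν^α` of `X^α`. -/
def law (α : Fin m) : Measure ℝ := P.map (M.X α)

/-- The information process `ξ_t = t X + vol β_t`, as a vector. -/
def info (α : Fin m) (t : I) (ω : Ω) : Fin (n α) → ℝ :=
  fun i => (t : ℝ) * M.X α ω + M.vol α i * M.β α i t ω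

/-- The modulated information process `J_t ξ_t`, with `J_t` a diagonal matrix. -/
def modulated (α : Fin m) (t : I) (ω : Ω) : Fin (n α) → ℝ :=
  (Matrix.diagonal (M.J α t ω)).mulVec (M.info α t ω)

/-- The σ-algebra generated by the modulated information and the switching processes up to time
`t`, and by `X 1_{t = 1}`. -/
def natSigma (t : I) : MeasurableSpace Ω :=
  (⨆ α, ⨆ u, ⨆ (_ : u ≤ t), (MeasurableSpace.comap (M.modulated α u) inferInstance ⊔
      MeasurableSpace.comap (M.J α u) inferInstance)) ⊔
    MeasurableSpace.comap (fun ω => ({1} : Set I).indicator (fun _ => M.vecX ω) t) inferInstance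

/-- `natSigma t` completed by the null sets of `P`. -/
def complSigma (t : I) : MeasurableSpace Ω :=
  M.natSigma t ⊔ MeasurableSpace.generateFrom {N | MeasurableSet N ∧ P N = 0}

/-- For `t < 1`: the time-`t` σ-algebra of the right-continuous completed filtration generated
by the observations. -/
def augSigma (t : I) : MeasurableSpace Ω := ⨅ s, ⨅ (_ : t < s), M.complSigma s

/-- The last time up to `t` at which source `i` was active (`0` if it was never active: the
supremum of the empty set in `[0,1]` is `0`). -/
def lastActive (α : Fin m) (i : Fin (n α)) (t : I) (ω : Ω) : I :=
  sSup {u : I | u ≤ t ∧ M.J α u ω i = 1}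

/-- The set of active sources. -/
def active (α : Fin m) (t : I) (ω : Ω) : Finset (Fin (n α)) :=
  Finset.univ.filter fun i => M.J α t ω i = 1

/-- The set of inactive sources. -/
def inactive (α : Fin m) (t : I) (ω : Ω) : Finset (Fin (n α)) :=
  Finset.univ.filter fun i => M.J α t ω i = 0

/-- The effective volatility `(∑_{i active} σ_i⁻²)^{-1/2}`, and `0` if no source is active. -/
def effVol (α : Fin m) (t : I) (ω : Ω) : ℝ :=
  if M.active α t ω = ∅ then 0 else (Real.sqrt (∑ i ∈ M.active α t ω, (M.vol α i ^ 2)⁻¹))⁻¹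

/-- The effective information process (equal to `0` if no source is active). -/
def effInfo (α : Fin m) (t : I) (ω : Ω) : ℝ :=
  M.effVol α t ω ^ 2 * ∑ i ∈ M.active α t ω, (M.vol α i ^ 2)⁻¹ * M.info α t ω i

/-- The complementary information, a random function of `x`. -/
def compInfo (α : Fin m) (t : I) (ω : Ω) (x : ℝ) : ℝ :=
  ∏ i ∈ M.inactive α t ω,
    gaussH x (M.info α (M.lastActive α i t ω) ω i) (M.lastActive α i t ω : ℝ) (M.vol α i)

/-- The pair (effective information, complementary information), the latter as a random element
of the space of functions on `𝕏` with the σ-algebra generated by the evaluations. -/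
def effCompPair (α : Fin m) (t : I) (ω : Ω) : ℝ × (𝕏 → ℝ) :=
  (M.effInfo α t ω, fun x => M.compInfo α t ω x)

/-- Effective information with its volatility parameter, and complementary information. -/
def effCompObs (α : Fin m) (t : I) (ω : Ω) : (ℝ × ℝ) × (𝕏 → ℝ) :=
  ((M.effInfo α t ω, M.effVol α t ω), fun x => M.compInfo α t ω x)

/-- The unnormalised density `h(x, ξ̂_t, t, σ̂_t) η_t(x)`. -/
def effWeight (α : Fin m) (t : I) (ω : Ω) (x : ℝ) : ℝ :=
  gaussH x (M.effInfo α t ω) (t : ℝ) (M.effVol α t ω) * M.compInfo α t ω x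

/-- The measure `h(x, ξ̂_t, t, σ̂_t) η_t(x) ν(dx) / ∫ h(x, ξ̂_t, t, σ̂_t) η_t(x) ν(dx)`. -/
def posterior (α : Fin m) (t : I) (ω : Ω) : Measure ℝ :=
  (∫⁻ x, ENNReal.ofReal (M.effWeight α t ω x) ∂(M.law α))⁻¹ •
    (M.law α).withDensity fun x => ENNReal.ofReal (M.effWeight α t ω x)

end InfoModel

/-- The random probability measure `κ` is a version of the conditional law of `Y` given the
sub-σ-algebra `𝓗`. -/
structure IsCondLaw {Ω E : Type*} [mΩ : MeasurableSpace Ω] [MeasurableSpace E] (P : Measure Ω)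
    (𝓗 : MeasurableSpace Ω) (Y : Ω → E) (κ : Ω → Measure E) : Prop where
  le : 𝓗 ≤ mΩ
  isProbabilityMeasure : ∀ ω, IsProbabilityMeasure (κ ω)
  condProb : ∀ A : Set E, MeasurableSet A →
    (fun ω => (κ ω).real A) =ᵐ[P] P[(Y ⁻¹' A).indicator (fun _ => (1 : ℝ)) | 𝓗]

end

noncomputable section

open scoped ENNReal NNReal

/-! ### Gaussian shifts -/

/-! Freeze the switching paths. They are independent of the factors and bridges, so they may be
treated as constants, and each source is then seen only up to a deterministic time T, its last
active time (`J_mul_info_eq`). The bridge up to T splits into β_T and the residual β_u − (u/T) β_T;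
these are jointly Gaussian and uncorrelated, hence independent (`indepFun_residual`). Thus ξ on [0,
T] is a function of ξ_T and of residuals independent of the factors and of the noise at T, and only
ξ_T informs about X (`lintegral_indicator_mul_stopped`). Since ξ_T is T X plus Gaussian noise of
variance σ² T (1 − T), `gaussH` is its likelihood ratio (`gaussianReal_shift_eq_withDensity`), and
Bayes' formula gives the posterior. Integrating over the frozen paths yields
`measure_inter_eq_lintegral_posteriorAt`.

Prior and likelihood are both products over the factors, so the posterior is a product too. Within a
factor, the active sources are all read at time t and their likelihoods merge into one of the same
form, with added precisions (`effWeight_eq_prod`). The resulting posterior depends on `effCompObs`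
alone, so by the tower property it is also the conditional law given `effCompObs`.

For the right-continuous completed filtration, let s decrease to t. Likelihoods converge pointwise,
since last active times are right-continuous, but for the normalisers only Fatou's inequality is
used. What survives is P(X ∈ A, H) ≤ ∫_H posterior(A), first for bounded A. Applied to H and to Hᶜ,
whose two inequalities sum to an equality, it is an equality. -/

lemma gaussH_pos (x y t s : ℝ) : 0 < gaussH x y t s := by
  unfold gaussH
  split_ifs <;> positivity

lemma Measurable.gaussH {E : Type*} {mE : MeasurableSpace E} {x y t s : E → ℝ} (hx : Measurable x)
    (hy : Measurable y) (ht : Measurable t) (hs : Measurable s) :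
    Measurable fun e => gaussH (x e) (y e) (t e) (s e) :=
  Measurable.ite (hs (measurableSet_singleton 0)) measurable_const (by fun_prop)

lemma continuous_gaussH_left (y t s : ℝ) : Continuous fun x => gaussH x y t s := by
  unfold gaussH
  split_ifs <;> fun_prop

/-- Shifting the mean of a centred Gaussian law of variance `σ² T (1 - T)` by `T x` amounts to
multiplying it by the density `gaussH x · T vol`. -/
lemma gaussianReal_shift_eq_withDensity {vol T : ℝ} (hvol : 0 < vol) (hT0 : 0 ≤ T) (hT1 : T < 1)
    (x : ℝ) {v : ℝ≥0} (hv : (v : ℝ) = vol ^ 2 * (T - T * T)) :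
    gaussianReal (T * x) v =
      (gaussianReal 0 v).withDensity fun y => ENNReal.ofReal (gaussH x y T vol) := by
  have hmeas : Measurable fun y => ENNReal.ofReal (gaussH x y T vol) :=
    (measurable_const.gaussH measurable_id measurable_const measurable_const).ennreal_ofReal
  -- At T = 0 both laws are the Dirac mass at 0, where the density equals 1; the formula for
  -- Gaussian densities needs positive variance.
  rcases hT0.eq_or_lt with rfl | hT0
  · have hv0 : v = 0 := by
      apply NNReal.coe_injective
      rw [hv]; simp
    subst hv0
    classical
    ext s hs
    rw [withDensity_apply _ hs, zero_mul, gaussianReal_zero_var, setLIntegral_dirac' hmeas hs,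
      Measure.dirac_apply' _ hs]
    by_cases h0 : (0 : ℝ) ∈ s <;> simp [gaussH, h0]
  · have h1 : 0 < 1 - T := by linarith
    have hvpos : (0 : ℝ) < v := by
      rw [hv]
      have : T - T * T = T * (1 - T) := by ring
      rw [this]; positivity
    have hv0 : v ≠ 0 := by
      rintro rfl; simp at hvpos
    rw [gaussianReal_of_var_ne_zero _ hv0, gaussianReal_of_var_ne_zero _ hv0,
      ← withDensity_mul _ (measurable_gaussianPDF _ _) hmeas]
    congr 1
    ext y
    simp only [Pi.mul_apply, gaussianPDF]
    rw [← ENNReal.ofReal_mul (gaussianPDFReal_nonneg _ _ _)]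
    congr 1
    simp only [gaussianPDFReal, gaussH, hvol.ne', if_false]
    -- With v = vol² T (1 − T), the exponents satisfy −(y − T x)²/(2v) = −y²/(2v) + (x y − T
    -- x²/2)/(vol² (1 − T)).
    rw [mul_assoc _ (Real.exp _) (Real.exp _), ← Real.exp_add, hv]
    congr 2
    have h2 : T - T * T = T * (1 - T) := by ring
    rw [h2]
    field_simp
    ring

/-- Coordinates are independent under a product measure, so expectations of products factorize; the
box is absorbed into the indicators of its sides. -/
lemma setLIntegral_univ_pi_prod {κ : Type*} [Fintype κ] (μ : κ → Measure ℝ)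
    [∀ k, IsProbabilityMeasure (μ k)] {f : κ → ℝ → ℝ≥0∞} (hf : ∀ k, Measurable (f k))
    {s : κ → Set ℝ} (hs : ∀ k, MeasurableSet (s k)) :
    ∫⁻ y in Set.univ.pi s, ∏ k, f k (y k) ∂Measure.pi μ = ∏ k, ∫⁻ y in s k, f k y ∂μ k := by
  rw [← lintegral_indicator (MeasurableSet.univ_pi hs)]
  have h1 : (Set.univ.pi s).indicator (fun y : κ → ℝ => ∏ k, f k (y k)) =
      fun y => ∏ k, (s k).indicator (f k) (y k) := by
    ext y
    by_cases hy : y ∈ Set.univ.pi s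
    · rw [Set.indicator_of_mem hy]
      exact Finset.prod_congr rfl fun k _ => (Set.indicator_of_mem (hy k (Set.mem_univ _)) _).symm
    · rw [Set.indicator_of_notMem hy]
      simp only [Set.mem_pi, Set.mem_univ, true_implies, not_forall] at hy
      obtain ⟨k, hk⟩ := hy
      exact (Finset.prod_eq_zero (Finset.mem_univ k) (Set.indicator_of_notMem hk _)).symm
  have h2 : ∀ k, Measurable ((s k).indicator (f k)) := fun k => (hf k).indicator (hs k)
  rw [h1, lintegral_prod_eq_prod_lintegral_of_indepFun (μ := Measure.pi μ) Finset.univ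
    (fun k y => (s k).indicator (f k) (y k))
    (iIndepFun_pi (X := fun k => (s k).indicator (f k)) fun k => (h2 k).aemeasurable)
    (fun k => (h2 k).comp (measurable_pi_apply k))]
  refine Finset.prod_congr rfl fun k _ => ?_
  rw [← lintegral_indicator (hs k),
    ← (measurePreserving_eval μ k).lintegral_comp (h2 k)]

lemma Measure.pi_withDensity {κ : Type*} [Fintype κ] (μ : κ → Measure ℝ)
    [∀ k, IsProbabilityMeasure (μ k)] (f : κ → ℝ → ℝ≥0∞) (hf : ∀ k, Measurable (f k))
    [∀ k, SigmaFinite ((μ k).withDensity (f k))] :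
    Measure.pi (fun k => (μ k).withDensity (f k)) =
      (Measure.pi μ).withDensity fun y => ∏ k, f k (y k) := by
  refine Measure.pi_eq fun s hs => ?_
  rw [withDensity_apply _ (MeasurableSet.univ_pi hs), setLIntegral_univ_pi_prod μ hf hs]
  exact Finset.prod_congr rfl fun k _ => (withDensity_apply _ (hs k)).symm

/-! ### Bayes' formula with a Gaussian likelihood -/

/-- The posterior `w(x) ν(dx) / ∫ w(x) ν(dx)` of a prior `ν` for the likelihood `w`. -/
def bayesPosterior {S : Type*} [MeasurableSpace S] (ν : Measure S) (w : S → ℝ≥0∞) : Measure S :=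
  (∫⁻ x, w x ∂ν)⁻¹ • ν.withDensity w

section Bayes

variable {S : Type*} [MeasurableSpace S] {κ : Type*} [Fintype κ]

lemma bayesPosterior_apply {ν : Measure S} {w : S → ℝ≥0∞} {A : Set S} (hA : MeasurableSet A) :
    bayesPosterior ν w A = (∫⁻ x, w x ∂ν)⁻¹ * ∫⁻ x in A, w x ∂ν := by
  rw [bayesPosterior, Measure.smul_apply, withDensity_apply _ hA, smul_eq_mul]

lemma bayesPosterior_le_one {ν : Measure S} {w : S → ℝ≥0∞} (A : Set S) :
    bayesPosterior ν w A ≤ 1 := by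
  refine (measure_mono (subset_univ A)).trans ?_
  rw [bayesPosterior_apply MeasurableSet.univ, Measure.restrict_univ]
  exact ENNReal.inv_mul_le_one _

instance {ν : Measure S} {w : S → ℝ≥0∞} : IsFiniteMeasure (bayesPosterior ν w) :=
  ⟨(bayesPosterior_le_one _).trans_lt ENNReal.one_lt_top⟩

lemma measurable_bayesPosterior_apply {E : Type*} {mE : MeasurableSpace E} {ν : Measure S} [SFinite ν]
    {w : E → S → ℝ≥0∞} (hw : Measurable (Function.uncurry w)) {A : Set S} (hA : MeasurableSet A) :
    Measurable fun e => bayesPosterior ν (w e) A := by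
  simp_rw [bayesPosterior_apply hA]
  exact hw.lintegral_prod_right'.inv.mul (hw.lintegral_prod_right' (ν := ν.restrict A))

lemma isProbabilityMeasure_bayesPosterior {ν : Measure S} {w : S → ℝ≥0∞}
    (h0 : ∫⁻ x, w x ∂ν ≠ 0) (h1 : ∫⁻ x, w x ∂ν ≠ ∞) :
    IsProbabilityMeasure (bayesPosterior ν w) :=
  ⟨by rw [bayesPosterior_apply MeasurableSet.univ, Measure.restrict_univ,
    ENNReal.inv_mul_cancel h0 h1]⟩

lemma lintegral_ne_zero_of_pos {ν : Measure S} [NeZero ν] {w : S → ℝ≥0∞} (hw : Measurable w)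
    (hpos : ∀ x, 0 < w x) : ∫⁻ x, w x ∂ν ≠ 0 := by
  rw [Ne, lintegral_eq_zero_iff hw]
  intro h0
  have : (ae ν).NeBot := ae_neBot.2 (NeZero.ne ν)
  obtain ⟨x, hx⟩ := h0.exists
  exact (hpos x).ne' hx

/-- Independent factors with separate observations have independent posteriors. -/
lemma bayesPosterior_pi {κ : Type*} [Fintype κ] (μ : κ → Measure ℝ)
    [∀ k, IsProbabilityMeasure (μ k)] {f : κ → ℝ → ℝ≥0∞} (hf : ∀ k, Measurable (f k))
    (h0 : ∀ k x, 0 < f k x) (h1 : ∫⁻ y, ∏ k, f k (y k) ∂Measure.pi μ ≠ ∞) :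
    (∀ k, ∫⁻ y, f k y ∂μ k ≠ ∞) ∧
      bayesPosterior (Measure.pi μ) (fun y => ∏ k, f k (y k)) =
        Measure.pi fun k => bayesPosterior (μ k) (f k) := by
  classical
  have hprod : ∫⁻ y, ∏ k, f k (y k) ∂Measure.pi μ = ∏ k, ∫⁻ y, f k y ∂μ k := by
    simpa using setLIntegral_univ_pi_prod μ hf (s := fun _ => Set.univ) fun _ => MeasurableSet.univ
  have hZ0 : ∀ k, ∫⁻ y, f k y ∂μ k ≠ 0 := fun k => lintegral_ne_zero_of_pos (hf k) (h0 k)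
  -- One infinite factor would make the whole product infinite, since no other factor is zero.
  have hZ1 : ∀ k, ∫⁻ y, f k y ∂μ k ≠ ∞ := by
    intro k hk
    apply h1
    rw [hprod, ← Finset.mul_prod_erase _ _ (Finset.mem_univ k), hk]
    exact ENNReal.top_mul (Finset.prod_ne_zero_iff.2 fun i _ => hZ0 i)
  refine ⟨hZ1, (Measure.pi_eq fun s hs => ?_).symm⟩
  rw [bayesPosterior_apply (MeasurableSet.univ_pi hs), setLIntegral_univ_pi_prod μ hf hs, hprod,
    ENNReal.prod_inv_distrib, ← Finset.prod_mul_distrib]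
  · exact Finset.prod_congr rfl fun k _ => (bayesPosterior_apply (hs k)).symm
  · exact fun i _ j _ _ => .inl (hZ0 i)

/-- The likelihood of the observations `y` of sources `k` at the times `T k`, with noise levels
`vol k`; the source `k` observes the coordinate `p k` of the signal. -/
def sourceLik (p : κ → S → ℝ) (vol T y : κ → ℝ) (x : S) : ℝ≥0∞ :=
  ∏ k, ENNReal.ofReal (gaussH (p k x) (y k) (T k) (vol k))

variable {p : κ → S → ℝ} {vol : κ → ℝ}

omit [MeasurableSpace S] in
lemma sourceLik_pos (T y : κ → ℝ) (x : S) : 0 < sourceLik p vol T y x :=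
  pos_iff_ne_zero.2 <| Finset.prod_ne_zero_iff.2 fun _ _ =>
    (ENNReal.ofReal_pos.2 (gaussH_pos _ _ _ _)).ne'

lemma Measurable.sourceLik (hp : ∀ k, Measurable (p k)) {E : Type*} {mE : MeasurableSpace E}
    {T y : E → κ → ℝ} {x : E → S} (hT : Measurable T) (hy : Measurable y) (hx : Measurable x) :
    Measurable fun e => sourceLik p vol (T e) (y e) (x e) := by
  refine Finset.measurable_prod _ fun k _ => Measurable.ennreal_ofReal ?_
  exact ((hp k).comp hx).gaussH ((measurable_pi_apply k).comp hy)
    ((measurable_pi_apply k).comp hT) measurable_const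

variable {Ω : Type*} [MeasurableSpace Ω] {P : Measure Ω} [IsProbabilityMeasure P]
  {U : Ω → S} {N : Ω → κ → ℝ} {T : κ → ℝ} {v : κ → ℝ≥0}

/-- Change of measure: the joint law of the signal and the observations has density `sourceLik`
with respect to the product of the law of the signal and the law of the noise. -/
lemma lintegral_signal_observation (hp : ∀ k, Measurable (p k)) (hvol : ∀ k, 0 < vol k)
    (hT0 : ∀ k, 0 ≤ T k) (hT1 : ∀ k, T k < 1)
    (hv : ∀ k, (v k : ℝ) = vol k ^ 2 * (T k - T k * T k)) (hU : Measurable U) (hN : Measurable N)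
    (hUN : IndepFun U N P) (hlaw : P.map N = Measure.pi fun k => gaussianReal 0 (v k))
    {F : S × (κ → ℝ) → ℝ≥0∞} (hF : Measurable F) :
    ∫⁻ ω, F (U ω, fun k => T k * p k (U ω) + N ω k) ∂P =
      ∫⁻ y, ∫⁻ x, sourceLik p vol T y x * F (x, y) ∂(P.map U)
        ∂(Measure.pi fun k => gaussianReal 0 (v k)) := by
  have : IsProbabilityMeasure (P.map U) := Measure.isProbabilityMeasure_map hU.aemeasurable
  have hlikm : Measurable fun q : S × (κ → ℝ) => sourceLik p vol T q.2 q.1 :=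
    Measurable.sourceLik hp measurable_const measurable_snd measurable_fst
  have hg : Measurable fun q : S × (κ → ℝ) => F (q.1, fun k => T k * p k q.1 + q.2 k) :=
    hF.comp (measurable_fst.prodMk (measurable_pi_lambda _ fun k =>
      (((hp k).comp measurable_fst).const_mul _).add ((measurable_pi_apply k).comp measurable_snd)))
  have h1 : ∫⁻ ω, F (U ω, fun k => T k * p k (U ω) + N ω k) ∂P =
      ∫⁻ q, F (q.1, fun k => T k * p k q.1 + q.2 k) ∂(P.map fun ω => (U ω, N ω)) :=
    (lintegral_map hg (hU.prodMk hN)).symm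
  rw [h1, (indepFun_iff_map_prod_eq_prod_map_map hU.aemeasurable hN.aemeasurable).1 hUN, hlaw,
    lintegral_prod _ hg.aemeasurable,
    lintegral_lintegral_swap (f := fun y x => sourceLik p vol T y x * F (x, y))]
  swap
  · exact ((hlikm.comp measurable_swap).mul (hF.comp measurable_swap)).aemeasurable
  -- For a fixed signal value x, the observation law is the noise law translated by `T k * p k x`,
  -- and the Gaussian shift formula turns this translation into the density `sourceLik`.
  refine lintegral_congr fun x => ?_
  have hshift : (Measure.pi fun k => gaussianReal 0 (v k)).map
      (fun y k => T k * p k x + y k) = Measure.pi fun k => gaussianReal (T k * p k x) (v k) := by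
    rw [Measure.pi_map_pi (μ := fun k => gaussianReal 0 (v k))
      (f := fun k y => T k * p k x + y) (fun k => by fun_prop)]
    congr 1
    ext k : 1
    rw [gaussianReal_map_const_add, zero_add]
  have hshift2 : (Measure.pi fun k => gaussianReal (T k * p k x) (v k)) =
      (Measure.pi fun k => gaussianReal 0 (v k)).withDensity fun y => sourceLik p vol T y x := by
    have hd := fun k => gaussianReal_shift_eq_withDensity (hvol k) (hT0 k) (hT1 k) (p k x) (hv k)
    have : ∀ k, SigmaFinite ((gaussianReal 0 (v k)).withDensity
        fun y => ENNReal.ofReal (gaussH (p k x) y (T k) (vol k))) := fun k => by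
      rw [← hd k]; infer_instance
    simp_rw [hd]
    exact Measure.pi_withDensity _ _ fun k =>
      (measurable_const.gaussH measurable_id measurable_const measurable_const).ennreal_ofReal
  have hFx : Measurable fun y => F (x, y) := hF.comp (by fun_prop)
  rw [← lintegral_map (f := fun y => F (x, y)) hFx (by fun_prop), hshift, hshift2,
    lintegral_withDensity_eq_lintegral_mul _ _ hFx]
  · rfl
  · exact Measurable.sourceLik hp measurable_const measurable_id measurable_const

/-- Testing the change of measure with F = 1 shows that the normaliser has integral 1 under the
noise law. Finiteness for every y may fail: at time 0 the likelihood is exp (x y / vol²), which need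
not be integrable for y ≠ 0. -/
lemma lintegral_sourceLik_ne_top (hp : ∀ k, Measurable (p k)) (hvol : ∀ k, 0 < vol k)
    (hT0 : ∀ k, 0 ≤ T k) (hT1 : ∀ k, T k < 1)
    (hv : ∀ k, (v k : ℝ) = vol k ^ 2 * (T k - T k * T k)) (hU : Measurable U) (hN : Measurable N)
    (hUN : IndepFun U N P) (hlaw : P.map N = Measure.pi fun k => gaussianReal 0 (v k)) :
    ∀ᵐ y ∂(Measure.pi fun k => gaussianReal 0 (v k)),
      ∫⁻ x, sourceLik p vol T y x ∂(P.map U) ≠ ∞ := by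
  have : IsProbabilityMeasure (P.map U) := Measure.isProbabilityMeasure_map hU.aemeasurable
  have h := lintegral_signal_observation hp hvol hT0 hT1 hv hU hN hUN hlaw
    (F := fun _ => 1) measurable_const
  simp only [lintegral_const, measure_univ, mul_one] at h
  have hm : Measurable fun y => ∫⁻ x, sourceLik p vol T y x ∂(P.map U) :=
    Measurable.lintegral_prod_right' (f := fun q : (κ → ℝ) × S => sourceLik p vol T q.1 q.2)
      (Measurable.sourceLik hp measurable_const measurable_fst measurable_snd)
  filter_upwards [ae_lt_top hm (by rw [← h]; exact ENNReal.one_ne_top)] with y hy using hy.ne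

/-- Bayes' formula for observations at deterministic times. -/
lemma lintegral_indicator_mul_eq_bayes (hp : ∀ k, Measurable (p k)) (hvol : ∀ k, 0 < vol k)
    (hT0 : ∀ k, 0 ≤ T k) (hT1 : ∀ k, T k < 1)
    (hv : ∀ k, (v k : ℝ) = vol k ^ 2 * (T k - T k * T k)) (hU : Measurable U) (hN : Measurable N)
    (hUN : IndepFun U N P) (hlaw : P.map N = Measure.pi fun k => gaussianReal 0 (v k))
    {A : Set S} (hA : MeasurableSet A) {f : (κ → ℝ) → ℝ≥0∞} (hf : Measurable f) :
    ∫⁻ ω, A.indicator 1 (U ω) * f (fun k => T k * p k (U ω) + N ω k) ∂P =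
      ∫⁻ ω, bayesPosterior (P.map U)
          (sourceLik p vol T fun k => T k * p k (U ω) + N ω k) A *
        f (fun k => T k * p k (U ω) + N ω k) ∂P := by
  have : IsProbabilityMeasure (P.map U) := Measure.isProbabilityMeasure_map hU.aemeasurable
  have hpost : Measurable fun y => bayesPosterior (P.map U) (sourceLik p vol T y) A :=
    measurable_bayesPosterior_apply (w := fun y => sourceLik p vol T y) (Measurable.sourceLik hp measurable_const measurable_fst measurable_snd) hA
  have hlikm : ∀ y, Measurable (sourceLik p vol T y) := fun y =>
    Measurable.sourceLik hp measurable_const measurable_const measurable_id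
  have h1 := lintegral_signal_observation hp hvol hT0 hT1 hv hU hN hUN hlaw
    (F := fun q => A.indicator 1 q.1 * f q.2)
    (((measurable_one.indicator hA).comp measurable_fst).mul (hf.comp measurable_snd))
  have h2 := lintegral_signal_observation hp hvol hT0 hT1 hv hU hN hUN hlaw
    (F := fun q => bayesPosterior (P.map U) (sourceLik p vol T q.2) A * f q.2)
    ((hpost.mul hf).comp measurable_snd)
  rw [h1, h2]
  refine lintegral_congr_ae ?_
  filter_upwards [lintegral_sourceLik_ne_top hp hvol hT0 hT1 hv hU hN hUN hlaw] with y hy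
  have hZ : ∫⁻ x, sourceLik p vol T y x ∂(P.map U) ≠ 0 :=
    lintegral_ne_zero_of_pos (hlikm y) (sourceLik_pos T y)
  -- The posterior mass on the right does not involve x, so the likelihood integrates to the
  -- normaliser, which cancels its own inverse because it is neither 0 nor ∞.
  rw [lintegral_mul_const _ (hlikm y), bayesPosterior_apply hA]
  simp_rw [← mul_assoc]
  rw [lintegral_mul_const]
  · congr 1
    rw [ENNReal.mul_inv_cancel hZ hy, one_mul, ← lintegral_indicator hA]
    refine lintegral_congr fun x => ?_
    by_cases hx : x ∈ A <;> simp [hx]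
  · exact (hlikm y).mul (measurable_one.indicator hA)

/-- The observation law has a density with respect to the noise law, so the null set of
`lintegral_sourceLik_ne_top` is also null for the actual observations. -/
lemma bayes_normalizer_ne_top (hp : ∀ k, Measurable (p k)) (hvol : ∀ k, 0 < vol k)
    (hT0 : ∀ k, 0 ≤ T k) (hT1 : ∀ k, T k < 1)
    (hv : ∀ k, (v k : ℝ) = vol k ^ 2 * (T k - T k * T k)) (hU : Measurable U) (hN : Measurable N)
    (hUN : IndepFun U N P) (hlaw : P.map N = Measure.pi fun k => gaussianReal 0 (v k)) :
    ∀ᵐ ω ∂P, ∫⁻ x, sourceLik p vol T (fun k => T k * p k (U ω) + N ω k) x ∂(P.map U) ≠ ∞ := by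
  have : IsProbabilityMeasure (P.map U) := Measure.isProbabilityMeasure_map hU.aemeasurable
  have hm : Measurable fun y => ∫⁻ x, sourceLik p vol T y x ∂(P.map U) :=
    Measurable.lintegral_prod_right' (f := fun q : (κ → ℝ) × S => sourceLik p vol T q.1 q.2)
      (Measurable.sourceLik hp measurable_const measurable_fst measurable_snd)
  have hB : MeasurableSet {y | ∫⁻ x, sourceLik p vol T y x ∂(P.map U) = ∞} :=
    hm (measurableSet_singleton _)
  have hξ : Measurable fun ω => fun k => T k * p k (U ω) + N ω k :=
    measurable_pi_lambda _ fun k =>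
      (((hp k).comp hU).const_mul _).add ((measurable_pi_apply k).comp hN)
  have h := lintegral_signal_observation hp hvol hT0 hT1 hv hU hN hUN hlaw
    (F := fun q => {y | ∫⁻ x, sourceLik p vol T y x ∂(P.map U) = ∞}.indicator 1 q.2)
    ((measurable_one.indicator hB).comp measurable_snd)
  have h0 : ∫⁻ y, ∫⁻ x, sourceLik p vol T y x *
      {y | ∫⁻ x, sourceLik p vol T y x ∂(P.map U) = ∞}.indicator 1 y ∂(P.map U)
        ∂(Measure.pi fun k => gaussianReal 0 (v k)) = 0 := by
    rw [← lintegral_zero]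
    refine lintegral_congr_ae ?_
    filter_upwards [lintegral_sourceLik_ne_top hp hvol hT0 hT1 hv hU hN hUN hlaw] with y hy
    simp [hy]
  rw [h0] at h
  filter_upwards [(lintegral_eq_zero_iff ((measurable_one.indicator hB).comp hξ)).1 h] with ω hω htop
  simp [htop] at hω

end Bayes

/-! ### Independence -/

/-- For independent `f` and `g`, the expectation of a function of the pair can be computed by
freezing `g`. -/
lemma ProbabilityTheory.IndepFun.lintegral_eq {Ω E F : Type*} [MeasurableSpace Ω]
    [MeasurableSpace E] [MeasurableSpace F] {P : Measure Ω} [IsProbabilityMeasure P] {f : Ω → E}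
    {g : Ω → F} (hfg : IndepFun f g P) (hf : Measurable f) (hg : Measurable g)
    {Ψ : E × F → ℝ≥0∞} (hΨ : Measurable Ψ) :
    ∫⁻ ω, Ψ (f ω, g ω) ∂P = ∫⁻ ω', ∫⁻ ω, Ψ (f ω, g ω') ∂P ∂P := by
  have h1 : ∫⁻ ω, Ψ (f ω, g ω) ∂P = ∫⁻ q, Ψ q ∂(P.map fun ω => (f ω, g ω)) :=
    (lintegral_map hΨ (hf.prodMk hg)).symm
  have : IsProbabilityMeasure (P.map f) := Measure.isProbabilityMeasure_map hf.aemeasurable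
  have : IsProbabilityMeasure (P.map g) := Measure.isProbabilityMeasure_map hg.aemeasurable
  rw [h1, (indepFun_iff_map_prod_eq_prod_map_map hf.aemeasurable hg.aemeasurable).1 hfg,
    lintegral_prod_symm _ hΨ.aemeasurable, lintegral_map hΨ.lintegral_prod_left' hg]
  exact lintegral_congr fun ω' => lintegral_map (hΨ.comp measurable_prodMk_right) hf

/-- If the `m i` are independent, and `a i` and `b i` are independent σ-algebras contained in
`m i`, then all the `a i` and `b i` are independent. -/
lemma ProbabilityTheory.iIndep.sumElim {Ω ι : Type*} [Fintype ι] [mΩ : MeasurableSpace Ω]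
    {P : Measure Ω} [IsProbabilityMeasure P] {m a b : ι → MeasurableSpace Ω} (h : iIndep m P)
    (ha : ∀ i, a i ≤ m i) (hb : ∀ i, b i ≤ m i) (hab : ∀ i, Indep (a i) (b i) P) :
    iIndep (Sum.elim a b) P := by
  classical
  rw [iIndep_iff]
  intro s f hf
  -- Padding with `univ` makes the intersection run over all indices, so that it can be grouped into
  -- the events g (inl i) ∩ g (inr i) of the independent σ-algebras `m i`.
  let g : ι ⊕ ι → Set Ω := fun j => if j ∈ s then f j else univ
  have hg : ∀ j, MeasurableSet[Sum.elim a b j] (g j) := fun j => by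
    by_cases hj : j ∈ s
    · simpa [g, hj] using hf j hj
    · simp [g, hj]
  have h1 : ⋂ j ∈ s, f j = ⋂ i, (g (.inl i) ∩ g (.inr i)) := by
    ext ω
    simp only [mem_iInter, mem_inter_iff]
    have : ∀ j, ω ∈ g j ↔ (j ∈ s → ω ∈ f j) := fun j => by
      by_cases hj : j ∈ s <;> simp [g, hj]
    simp only [this]
    exact ⟨fun h i => ⟨h _, h _⟩, fun h j => by rcases j with i | i; exacts [(h i).1, (h i).2]⟩
  have h2 : ∏ j ∈ s, P (f j) = ∏ j, P (g j) := by
    rw [← Finset.prod_subset (Finset.subset_univ s)]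
    · exact Finset.prod_congr rfl fun j hj => by simp [g, hj]
    · intro j _ hj
      simp [g, hj]
  rw [h1, h2, h.meas_iInter fun i => (ha i _ (hg (.inl i))).inter (hb i _ (hg (.inr i))),
    Fintype.prod_sum_type, ← Finset.prod_mul_distrib]
  exact Finset.prod_congr rfl fun i _ =>
    (Indep_iff _ _ _).1 (hab i) _ _ (hg (.inl i)) (hg (.inr i))

/-! ### Brownian bridges -/

/-- The part of the path of `β` up to time `T` which is left over after regression on `β T`
(the path being stopped at `T`). -/
def bridgeResidual {Ω : Type*} (β : I → Ω → ℝ) (T u : I) (ω : Ω) : ℝ :=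
  β (u ⊓ T) ω - ((u ⊓ T : I) : ℝ) / T * β T ω

section Bridge

variable {Ω : Type*} [MeasurableSpace Ω] {P : Measure Ω} [IsProbabilityMeasure P]
  {β : I → Ω → ℝ}

lemma measurable_bridgeResidual (hβ : ∀ t, Measurable (β t)) (T u : I) :
    Measurable (bridgeResidual β T u) :=
  (hβ _).sub ((hβ _).const_mul _)

namespace IsBrownianBridge

variable (hβ : IsBrownianBridge β P)
include hβ

/-- Both are linear images of one Gaussian process, so vanishing covariance suffices. With s = u ⊓ T
it equals (s − s T) − (s/T)(T − T²) = 0. -/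
lemma indepFun_residual (T : I) :
    IndepFun (β T) (fun ω u => bridgeResidual β T u ω) P := by
  have hG : IsGaussianProcess (Sum.elim (fun u => bridgeResidual β T u) fun _ : Unit => β T) P := by
    classical
    refine hβ.gaussian.of_isGaussianProcess fun j => ?_
    rcases j with u | _
    · refine ⟨{u ⊓ T, T},
        { toFun x := x ⟨u ⊓ T, by simp⟩ - ((u ⊓ T : I) : ℝ) / T * x ⟨T, by simp⟩
          map_add' x y := by simp; ring
          map_smul' c x := by simp; ring }, fun ω => ?_⟩
      simp [bridgeResidual]
    · refine ⟨{T},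
        { toFun x := x ⟨T, by simp⟩
          map_add' := by simp
          map_smul' := by simp }, fun ω => ?_⟩
      simp
  have hL2 : ∀ u, MemLp (β u) 2 P := fun u => (hβ.gaussian.hasGaussianLaw_eval u).memLp_two
  have h := hG.indepFun_of_covariance_eq_zero
    (fun u => (measurable_bridgeResidual hβ.measurable T u).aemeasurable)
    (fun _ => (hβ.measurable T).aemeasurable) fun u _ => by
      have : bridgeResidual β T u = β (u ⊓ T) - fun ω => ((u ⊓ T : I) : ℝ) / T * β T ω := rfl
      rw [this, covariance_sub_left (hL2 _) ((hL2 T).const_mul _) (hL2 T),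
        covariance_const_mul_left, hβ.cov_eq, hβ.cov_eq]
      have h1 : ((u ⊓ T : I) : ℝ) ≤ T := inf_le_right (a := u) (b := T)
      rw [min_eq_left h1, min_self]
      -- At T = 0 the quotient s/T is 0 by convention, and s = 0 as well.
      by_cases hT : (T : ℝ) = 0
      · have : ((u ⊓ T : I) : ℝ) = 0 := le_antisymm (hT ▸ h1) (u ⊓ T).2.1
        simp [this]
      · field_simp
        ring
  exact h.symm.comp (φ := fun x : Unit → ℝ => x ()) (measurable_pi_apply ()) measurable_id

omit [IsProbabilityMeasure P] in
lemma map_const_mul_eval (c : ℝ) (T : I) {v : ℝ≥0}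
    (hv : (v : ℝ) = c ^ 2 * ((T : ℝ) - T * T)) :
    P.map (fun ω => c * β T ω) = gaussianReal 0 v := by
  have h1 : P.map (β T) = gaussianReal 0 ((T : ℝ) - T * T).toNNReal := by
    rw [(hβ.gaussian.hasGaussianLaw_eval T).map_eq_gaussianReal, hβ.mean_zero,
      ← covariance_self (hβ.measurable T).aemeasurable, hβ.cov_eq, min_self]
  have h2 : P.map (fun ω => c * β T ω) = (P.map (β T)).map (c * ·) := by
    rw [Measure.map_map (by fun_prop) (hβ.measurable T)]; rfl
  rw [h2, h1, gaussianReal_map_const_mul, mul_zero]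
  congr 1
  apply NNReal.coe_injective
  have : (0 : ℝ) ≤ (T : ℝ) - T * T := by nlinarith [T.2.1, T.2.2]
  simp [hv, this]

omit [IsProbabilityMeasure P] in
lemma ae_eval_zero : ∀ᵐ ω ∂P, β 0 ω = 0 := by
  have h := hβ.map_const_mul_eval 1 0 (v := 0) (by simp)
  simp only [one_mul, gaussianReal_zero_var] at h
  have h2 : ∀ᵐ x ∂(P.map (β 0)), x = 0 := by
    have : (fun ω => β 0 ω) = β 0 := rfl
    rw [← this, h, ae_dirac_eq]; rfl
  exact ae_of_ae_map (hβ.measurable 0).aemeasurable h2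

end IsBrownianBridge

end Bridge

/-! ### Bounds for σ-algebras generated by tuples and compositions -/

section Comap

variable {Ω : Type*} {𝓐 : MeasurableSpace Ω}

lemma comap_pi_le {ι : Type*} {E : ι → Type*} [∀ i, MeasurableSpace (E i)] {f : Ω → ∀ i, E i}
    (h : ∀ i, MeasurableSpace.comap (fun ω => f ω i) inferInstance ≤ 𝓐) :
    MeasurableSpace.comap f inferInstance ≤ 𝓐 :=
  (measurable_pi_lambda _ fun i => (comap_measurable _).mono (h i) le_rfl).comap_le

lemma comap_prodMk_le {E F : Type*} [MeasurableSpace E] [MeasurableSpace F] {f : Ω → E} {g : Ω → F}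
    (hf : MeasurableSpace.comap f inferInstance ≤ 𝓐)
    (hg : MeasurableSpace.comap g inferInstance ≤ 𝓐) :
    MeasurableSpace.comap (fun ω => (f ω, g ω)) inferInstance ≤ 𝓐 :=
  (((comap_measurable f).mono hf le_rfl).prodMk ((comap_measurable g).mono hg le_rfl)).comap_le

lemma comap_comp_le {E F : Type*} [MeasurableSpace E] [MeasurableSpace F] {f : Ω → E} {g : E → F}
    (hg : Measurable g) (hf : MeasurableSpace.comap f inferInstance ≤ 𝓐) :
    MeasurableSpace.comap (fun ω => g (f ω)) inferInstance ≤ 𝓐 :=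
  (hg.comp ((comap_measurable f).mono hf le_rfl)).comap_le

end Comap

/-! ### Bayes' formula with independent side information -/

section BayesResidual

variable {S : Type*} [MeasurableSpace S] {κ : Type*} [Fintype κ] {p : κ → S → ℝ} {vol : κ → ℝ}
  {Ω E : Type*} [MeasurableSpace Ω] [MeasurableSpace E] {P : Measure Ω} [IsProbabilityMeasure P]
  {U : Ω → S} {N : Ω → κ → ℝ} {R : Ω → E} {T : κ → ℝ} {v : κ → ℝ≥0}

/-- Bayes' formula for observations at deterministic times, with additional independent
information `R`. -/
lemma lintegral_indicator_mul_eq_bayes_of_indepFun (hp : ∀ k, Measurable (p k))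
    (hvol : ∀ k, 0 < vol k) (hT0 : ∀ k, 0 ≤ T k) (hT1 : ∀ k, T k < 1)
    (hv : ∀ k, (v k : ℝ) = vol k ^ 2 * (T k - T k * T k)) (hU : Measurable U) (hN : Measurable N)
    (hR : Measurable R) (hUN : IndepFun U N P)
    (hlaw : P.map N = Measure.pi fun k => gaussianReal 0 (v k))
    (hind : IndepFun (fun ω => (U ω, N ω)) R P)
    {A : Set S} (hA : MeasurableSet A) {f : (κ → ℝ) × E → ℝ≥0∞} (hf : Measurable f) :
    ∫⁻ ω, A.indicator 1 (U ω) * f (fun k => T k * p k (U ω) + N ω k, R ω) ∂P =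
      ∫⁻ ω, bayesPosterior (P.map U)
          (sourceLik p vol T fun k => T k * p k (U ω) + N ω k) A *
        f (fun k => T k * p k (U ω) + N ω k, R ω) ∂P := by
  have : IsProbabilityMeasure (P.map U) := Measure.isProbabilityMeasure_map hU.aemeasurable
  have hV : Measurable fun ω => (U ω, N ω) := hU.prodMk hN
  have hξ : Measurable fun q : (S × (κ → ℝ)) × E => fun k => T k * p k q.1.1 + q.1.2 k :=
    measurable_pi_lambda _ fun k =>
      (((hp k).comp (measurable_fst.comp measurable_fst)).const_mul _).add
        ((measurable_pi_apply k).comp (measurable_snd.comp measurable_fst))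
  have hpost : Measurable fun y => bayesPosterior (P.map U) (sourceLik p vol T y) A :=
    measurable_bayesPosterior_apply (w := fun y => sourceLik p vol T y)
      (Measurable.sourceLik hp measurable_const measurable_fst measurable_snd) hA
  have hfm := hf.comp (hξ.prodMk measurable_snd)
  have h1 := hind.lintegral_eq hV hR
    (((measurable_one.indicator hA).comp (measurable_fst.comp measurable_fst)).mul hfm)
  have h2 := hind.lintegral_eq hV hR ((hpost.comp hξ).mul hfm)
  refine h1.trans (Eq.trans (lintegral_congr fun ω' => ?_) h2.symm)
  exact lintegral_indicator_mul_eq_bayes hp hvol hT0 hT1 hv hU hN hUN hlaw hA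
    (hf.comp (measurable_id.prodMk measurable_const))

end BayesResidual

/-! ### Measurability of the last active time -/

section LastTime

variable {Ω : Type*} {t : I} {j g : I → Ω → ℝ}

/-- A dense sequence in `[0,t]` which starts at `t`. -/
def denseUpTo (t : I) : ℕ → I
  | 0 => t
  | n + 1 => TopologicalSpace.denseSeq I n ⊓ t

lemma denseUpTo_le (t : I) (n : ℕ) : denseUpTo t n ≤ t := by
  cases n
  · exact le_rfl
  · exact inf_le_right

/-- A right-continuous {0,1}-valued path stays at 1 on some interval to the right of u. If u < t,
that interval contains a dense point below t; if u = t, it may not, which is why the sequence starts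
at t itself. -/
lemma exists_denseUpTo_ge (hval : ∀ u ω, j u ω = 0 ∨ j u ω = 1)
    (hcont : ∀ ω u, ContinuousWithinAt (fun u => j u ω) (Ici u) u) {ω : Ω} {u : I} (hut : u ≤ t)
    (hu : j u ω = 1) : ∃ k, j (denseUpTo t k) ω = 1 ∧ u ≤ denseUpTo t k := by
  rcases hut.eq_or_lt with rfl | hlt
  · exact ⟨0, hu, le_rfl⟩
  have h1 : {x | 0 < j x ω} ∈ 𝓝[≥] u :=
    hcont ω u (Ioi_mem_nhds (by simp [hu]))
  obtain ⟨w, hw, hsub⟩ := (mem_nhdsGE_iff_exists_Ico_subset' hlt).1 h1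
  obtain ⟨_, ⟨k, rfl⟩, hk⟩ := (TopologicalSpace.denseRange_denseSeq I).exists_between
    (lt_inf_iff.2 ⟨hw, hlt⟩)
  have hk' : denseUpTo t (k + 1) = TopologicalSpace.denseSeq I k :=
    inf_eq_left.2 (hk.2.le.trans inf_le_right)
  refine ⟨k + 1, ?_, hk' ▸ hk.1.le⟩
  rw [hk']
  exact (hval _ ω).resolve_left (hsub ⟨hk.1.le, hk.2.trans_le inf_le_left⟩).ne'

open Classical in
/-- The largest of the first `n` points of `denseUpTo t` at which `j = 1`. -/
def lastAmong (t : I) (j : I → Ω → ℝ) : ℕ → Ω → I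
  | 0, _ => ⊥
  | n + 1, ω => lastAmong t j n ω ⊔ if j (denseUpTo t n) ω = 1 then denseUpTo t n else ⊥

open Classical in
/-- The value of `j * g` at `lastAmong t j n` (`0` if there is no such time). -/
def valueAtLast (t : I) (j g : I → Ω → ℝ) : ℕ → Ω → ℝ
  | 0, _ => 0
  | n + 1, ω =>
    if j (denseUpTo t n) ω = 1 ∧ lastAmong t j n ω ≤ denseUpTo t n then
      j (denseUpTo t n) ω * g (denseUpTo t n) ω
    else valueAtLast t j g n ω

lemma lastAmong_mono (ω : Ω) : Monotone fun n => lastAmong t j n ω :=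
  monotone_nat_of_le_succ fun _ => le_sup_left

lemma tendsto_lastAmong (hval : ∀ u ω, j u ω = 0 ∨ j u ω = 1)
    (hcont : ∀ ω u, ContinuousWithinAt (fun u => j u ω) (Ici u) u) (ω : Ω) :
    Tendsto (fun n => lastAmong t j n ω) atTop (𝓝 (sSup {u | u ≤ t ∧ j u ω = 1})) := by
  refine tendsto_atTop_isLUB (lastAmong_mono ω) ⟨?_, ?_⟩
  · rintro _ ⟨n, rfl⟩
    induction n with
    | zero => exact bot_le
    | succ n ih =>
      refine sup_le ih ?_
      split_ifs with h
      · exact le_sSup ⟨denseUpTo_le t n, h⟩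
      · exact bot_le
  · refine fun w hw => sSup_le fun u hu => ?_
    obtain ⟨k, hk, huk⟩ := exists_denseUpTo_ge hval hcont hu.1 hu.2
    refine huk.trans (le_trans ?_ (hw ⟨k + 1, rfl⟩))
    simp [lastAmong, hk]

lemma valueAtLast_eq (ω : Ω) (n : ℕ) :
    ((∀ k < n, j (denseUpTo t k) ω ≠ 1) ∧ valueAtLast t j g n ω = 0) ∨
      ((∃ k < n, j (denseUpTo t k) ω = 1) ∧
        valueAtLast t j g n ω = g (lastAmong t j n ω) ω) := by
  induction n with
  | zero => exact .inl ⟨by simp, rfl⟩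
  | succ n ih =>
    by_cases h : j (denseUpTo t n) ω = 1
    · refine .inr ⟨⟨n, n.lt_succ_self, h⟩, ?_⟩
      by_cases hle : lastAmong t j n ω ≤ denseUpTo t n
      · simp [valueAtLast, lastAmong, h, hle]
      · have h0 : denseUpTo t n ≤ lastAmong t j n ω := (not_le.1 hle).le
        simp only [valueAtLast, lastAmong, h, hle, and_false, if_false, if_true,
          sup_eq_left.2 h0]
        rcases ih with ⟨hall, _⟩ | ⟨_, h2⟩
        -- Without an earlier active point `lastAmong` is still ⊥, which lies below every point,
        -- contrary to `hle`.
        · exfalso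
          apply hle
          have : ∀ k ≤ n, lastAmong t j k ω = ⊥ := by
            intro k hk
            induction k with
            | zero => rfl
            | succ k ihk =>
              simp [lastAmong, ihk (Nat.le_of_succ_le hk), hall k hk]
          rw [this n le_rfl]
          exact bot_le
        · exact h2
    · rcases ih with ⟨hall, h2⟩ | ⟨⟨k, hk, hk1⟩, h2⟩
      · refine .inl ⟨fun k hk => ?_, ?_⟩
        · rcases Nat.lt_succ_iff_lt_or_eq.1 hk with hk | rfl
          exacts [hall k hk, h]
        · simpa [valueAtLast, h] using h2
      · refine .inr ⟨⟨k, hk.trans n.lt_succ_self, hk1⟩, ?_⟩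
        simpa [valueAtLast, lastAmong, h] using h2

open Classical in
lemma tendsto_valueAtLast (hval : ∀ u ω, j u ω = 0 ∨ j u ω = 1)
    (hcont : ∀ ω u, ContinuousWithinAt (fun u => j u ω) (Ici u) u)
    (hg : ∀ ω, Continuous fun u => g u ω) (ω : Ω) :
    Tendsto (fun n => valueAtLast t j g n ω) atTop
      (𝓝 (if {u | u ≤ t ∧ j u ω = 1}.Nonempty then g (sSup {u | u ≤ t ∧ j u ω = 1}) ω else 0)) := by
  split_ifs with hne
  · obtain ⟨u, hu⟩ := hne
    obtain ⟨k, hk, _⟩ := exists_denseUpTo_ge hval hcont hu.1 hu.2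
    refine (((hg ω).tendsto _).comp (tendsto_lastAmong hval hcont ω)).congr' ?_
    filter_upwards [eventually_gt_atTop k] with n hn
    rcases valueAtLast_eq (t := t) (j := j) (g := g) ω n with h | h
    · exact absurd hk (h.1 k hn)
    · exact h.2.symm
  · refine tendsto_const_nhds.congr fun n => ?_
    rcases valueAtLast_eq (t := t) (j := j) (g := g) ω n with h | ⟨⟨k, _, hk⟩, _⟩
    · exact h.2.symm
    · exact absurd ⟨_, denseUpTo_le t k, hk⟩ hne

variable {mΩ : MeasurableSpace Ω}

lemma measurable_lastAmong (hj : ∀ u ≤ t, Measurable (j u)) (n : ℕ) :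
    Measurable (lastAmong t j n) := by
  classical
  induction n with
  | zero => exact measurable_const
  | succ n ih =>
    exact ih.sup (Measurable.ite (hj _ (denseUpTo_le t n) (measurableSet_singleton 1))
      measurable_const measurable_const)

lemma measurable_lastTime (hval : ∀ u ω, j u ω = 0 ∨ j u ω = 1)
    (hcont : ∀ ω u, ContinuousWithinAt (fun u => j u ω) (Ici u) u)
    (hj : ∀ u ≤ t, Measurable (j u)) :
    Measurable fun ω => sSup {u | u ≤ t ∧ j u ω = 1} :=
  measurable_of_tendsto_metrizable (measurable_lastAmong hj)
    (tendsto_pi_nhds.2 (tendsto_lastAmong hval hcont))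

open Classical in
-- Measurability is required of `j u` and `j u * g u` only, not of `g u`: a path seen through j g
-- can still be read at its last visible time. The approximations `valueAtLast` use only such
-- products, and continuity of g identifies their limit.
lemma measurable_valueAtLastTime (hval : ∀ u ω, j u ω = 0 ∨ j u ω = 1)
    (hcont : ∀ ω u, ContinuousWithinAt (fun u => j u ω) (Ici u) u)
    (hg : ∀ ω, Continuous fun u => g u ω) (hj : ∀ u ≤ t, Measurable (j u))
    (hjg : ∀ u ≤ t, Measurable fun ω => j u ω * g u ω) :
    Measurable fun ω => if {u | u ≤ t ∧ j u ω = 1}.Nonempty then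
      g (sSup {u | u ≤ t ∧ j u ω = 1}) ω else 0 := by
  refine measurable_of_tendsto_metrizable (f := valueAtLast t j g) (fun n => ?_)
    (tendsto_pi_nhds.2 (tendsto_valueAtLast hval hcont hg))
  induction n with
  | zero => exact measurable_const
  | succ n ih =>
    exact Measurable.ite ((hj _ (denseUpTo_le t n) (measurableSet_singleton 1)).inter
      (measurable_lastAmong hj n measurableSet_Iic)) (hjg _ (denseUpTo_le t n)) ih

end LastTime

namespace InfoModel

variable {Ω : Type*} [MeasurableSpace Ω] {P : Measure Ω} {m : ℕ} {n : Fin m → ℕ} {𝕏 : Set ℝ}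
  (M : InfoModel P m n 𝕏)

/-! ### Observations at deterministic times -/

lemma measurable_vecX : Measurable M.vecX := measurable_pi_lambda _ M.X_measurable

lemma measurable_info (α : Fin m) (t : I) (i : Fin (n α)) : Measurable fun ω => M.info α t ω i :=
  ((M.X_measurable α).const_mul _).add (((M.bridge α i).measurable t).const_mul _)

lemma continuous_info (α : Fin m) (ω : Ω) (i : Fin (n α)) : Continuous fun t => M.info α t ω i := by
  have := (M.bridge α i).continuous_paths ω
  unfold info
  fun_prop

lemma info_zero_ae : ∀ᵐ ω ∂P, ∀ α i, M.info α 0 ω i = 0 := by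
  refine ae_all_iff.2 fun α => ae_all_iff.2 fun i => ?_
  filter_upwards [(M.bridge α i).ae_eval_zero] with ω hω
  simp [info, hω]

/-- The information of all sources, the source `k` being observed at time `T k`. -/
def infoAt (T : ((α : Fin m) × Fin (n α)) → I) (ω : Ω) (k : (α : Fin m) × Fin (n α)) : ℝ :=
  M.info k.1 (T k) ω k.2

/-- The posterior of the vector of factors if the value `y k` of source `k` is known at time `T k`. -/
def jointPosterior (T y : ((α : Fin m) × Fin (n α)) → ℝ) : Measure (Fin m → ℝ) :=
  bayesPosterior (P.map M.vecX) (sourceLik (fun k x => x k.1) (fun k => M.vol k.1 k.2) T y)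

lemma sourceSigma_le (i : Fin m ⊕ ((α : Fin m) × Fin (n α)) ⊕ Fin m) :
    sourceSigma M.X M.β M.J i ≤ ‹MeasurableSpace Ω› := by
  rcases i with α | k | α
  · exact (M.X_measurable α).comap_le
  · exact (measurable_pi_lambda _ fun t => (M.bridge k.1 k.2).measurable t).comap_le
  · exact (measurable_pi_lambda _ fun t => M.J_measurable α t).comap_le

lemma comap_noise_le (T : I) (k : (α : Fin m) × Fin (n α)) :
    MeasurableSpace.comap (M.β k.1 k.2 T) inferInstance ≤
      sourceSigma M.X M.β M.J (.inr (.inl k)) := by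
  rintro _ ⟨s, hs, rfl⟩
  exact ⟨(fun f : I → ℝ => f T) ⁻¹' s, measurable_pi_apply T hs, rfl⟩

lemma comap_bridgeResidual_le (T : I) (k : (α : Fin m) × Fin (n α)) :
    MeasurableSpace.comap (fun ω u => bridgeResidual (M.β k.1 k.2) T u ω) inferInstance ≤
      sourceSigma M.X M.β M.J (.inr (.inl k)) := by
  rintro _ ⟨s, hs, rfl⟩
  have : Measurable fun (f : I → ℝ) u => f (u ⊓ T) - ((u ⊓ T : I) : ℝ) / T * f T :=
    measurable_pi_lambda _ fun u => by fun_prop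
  exact ⟨_, this hs, rfl⟩

/-- The noise terms at the times `T`. -/
def noiseAt (T : ((α : Fin m) × Fin (n α)) → I) (ω : Ω) (k : (α : Fin m) × Fin (n α)) : ℝ :=
  M.vol k.1 k.2 * M.β k.1 k.2 (T k) ω

/-- The parts of the noise paths up to the times `T` which are independent of `noiseAt T`. -/
def residualAt (T : ((α : Fin m) × Fin (n α)) → I) (ω : Ω) (k : (α : Fin m) × Fin (n α)) (u : I) :
    ℝ :=
  bridgeResidual (M.β k.1 k.2) (T k) u ω

lemma measurable_noiseAt (T : ((α : Fin m) × Fin (n α)) → I) : Measurable (M.noiseAt T) :=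
  measurable_pi_lambda _ fun k => ((M.bridge k.1 k.2).measurable (T k)).const_mul _

lemma measurable_residualAt (T : ((α : Fin m) × Fin (n α)) → I) : Measurable (M.residualAt T) :=
  measurable_pi_lambda _ fun k => measurable_pi_lambda _ fun u =>
    measurable_bridgeResidual (M.bridge k.1 k.2).measurable (T k) u

variable [IsProbabilityMeasure P]

/-- Each bridge σ-algebra contains two independent pieces, the value at T and the residual. By
`iIndep.sumElim` all factors, values and residuals are jointly independent, and can then be
regrouped. -/
lemma indepFun_vecX_noiseAt_residualAt (T : ((α : Fin m) × Fin (n α)) → I) :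
    IndepFun (fun ω => (M.vecX ω, M.noiseAt T ω)) (M.residualAt T) P := by
  let a : Fin m ⊕ ((α : Fin m) × Fin (n α)) ⊕ Fin m → MeasurableSpace Ω
    | .inl α => MeasurableSpace.comap (M.X α) inferInstance
    | .inr (.inl k) => MeasurableSpace.comap (M.β k.1 k.2 (T k)) inferInstance
    | .inr (.inr _) => ⊥
  let b : Fin m ⊕ ((α : Fin m) × Fin (n α)) ⊕ Fin m → MeasurableSpace Ω
    | .inl _ => ⊥
    | .inr (.inl k) =>
      MeasurableSpace.comap (fun ω u => bridgeResidual (M.β k.1 k.2) (T k) u ω) inferInstance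
    | .inr (.inr _) => ⊥
  have ha : ∀ i, a i ≤ sourceSigma M.X M.β M.J i := by
    rintro (α | k | α)
    exacts [le_rfl, M.comap_noise_le (T k) k, bot_le]
  have hb : ∀ i, b i ≤ sourceSigma M.X M.β M.J i := by
    rintro (α | k | α)
    exacts [bot_le, M.comap_bridgeResidual_le (T k) k, bot_le]
  have hab : ∀ i, Indep (a i) (b i) P := by
    rintro (α | k | α)
    · exact indep_bot_right _
    · exact (M.bridge k.1 k.2).indepFun_residual (T k)
    · exact indep_bot_right _
  have h := indep_iSup_of_disjoint (fun i => by
    rcases i with i | i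
    exacts [(ha i).trans (M.sourceSigma_le i), (hb i).trans (M.sourceSigma_le i)])
    (M.indep.sumElim ha hb hab) (isCompl_range_inl_range_inr).disjoint
  refine indep_of_indep_of_le h ?_ ?_
  · refine comap_prodMk_le (comap_pi_le fun α => ?_) (comap_pi_le fun k =>
      comap_comp_le (f := M.β k.1 k.2 (T k)) (measurable_const_mul (M.vol k.1 k.2)) ?_)
    · exact le_iSup₂_of_le (Sum.inl (Sum.inl α)) ⟨_, rfl⟩ le_rfl
    · exact le_iSup₂_of_le (Sum.inl (Sum.inr (Sum.inl k))) ⟨_, rfl⟩ le_rfl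
  · exact comap_pi_le fun k => le_iSup₂_of_le (Sum.inr (Sum.inr (Sum.inl k))) ⟨_, rfl⟩ le_rfl

omit [IsProbabilityMeasure P] in
lemma indepFun_vecX_noiseAt (T : ((α : Fin m) × Fin (n α)) → I) :
    IndepFun M.vecX (M.noiseAt T) P := by
  have h := indep_iSup_of_disjoint M.sourceSigma_le M.indep (isCompl_range_inl_range_inr).disjoint
  refine indep_of_indep_of_le h ?_ ?_
  · exact comap_pi_le fun α => le_iSup₂_of_le (Sum.inl α) ⟨_, rfl⟩ le_rfl
  · exact comap_pi_le fun k =>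
      comap_comp_le (f := M.β k.1 k.2 (T k)) (measurable_const_mul (M.vol k.1 k.2))
        ((M.comap_noise_le (T k) k).trans (le_iSup₂_of_le (Sum.inr (Sum.inl k)) ⟨_, rfl⟩ le_rfl))

/-- The variances of the noise terms at the times `T`. -/
def noiseVar (T : ((α : Fin m) × Fin (n α)) → I) (k : (α : Fin m) × Fin (n α)) : ℝ≥0 :=
  (M.vol k.1 k.2 ^ 2 * ((T k : ℝ) - T k * T k)).toNNReal

omit [IsProbabilityMeasure P] in
lemma coe_noiseVar (T : ((α : Fin m) × Fin (n α)) → I) (k : (α : Fin m) × Fin (n α)) :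
    (M.noiseVar T k : ℝ) = M.vol k.1 k.2 ^ 2 * ((T k : ℝ) - T k * T k) :=
  Real.coe_toNNReal _ (mul_nonneg (sq_nonneg _) (by nlinarith [(T k).2.1, (T k).2.2]))

omit [IsProbabilityMeasure P] in
lemma map_noiseAt (T : ((α : Fin m) × Fin (n α)) → I) :
    P.map (M.noiseAt T) = Measure.pi fun k => gaussianReal 0 (M.noiseVar T k) := by
  have h : iIndepFun (fun k ω => M.noiseAt T ω k) P := by
    refine iIndep_of_iIndep_of_le
      (M.indep.precomp (Sum.inr_injective.comp Sum.inl_injective)) fun k => ?_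
    exact comap_comp_le (f := M.β k.1 k.2 (T k)) (measurable_const_mul (M.vol k.1 k.2))
      (M.comap_noise_le (T k) k)
  have h2 := h.map_fun_eq_pi_map fun k =>
    ((measurable_pi_apply k).comp (M.measurable_noiseAt T)).aemeasurable
  refine h2.trans ?_
  congr 1
  ext k : 1
  exact (M.bridge k.1 k.2).map_const_mul_eval _ _ (M.coe_noiseVar T k)

omit [IsProbabilityMeasure P] in
/-- The information of source `k` up to time `T k` in terms of its value at `T k`. -/
lemma info_inf_eq (T : ((α : Fin m) × Fin (n α)) → I) (ω : Ω) (k : (α : Fin m) × Fin (n α))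
    (u : I) : M.info k.1 (u ⊓ T k) ω k.2 =
      ((u ⊓ T k : I) : ℝ) / T k * M.infoAt T ω k + M.vol k.1 k.2 * M.residualAt T ω k u := by
  simp only [info, infoAt, residualAt, bridgeResidual]
  by_cases hT : (T k : ℝ) = 0
  · have : ((u ⊓ T k : I) : ℝ) = 0 :=
      le_antisymm (hT ▸ (inf_le_right (a := u) (b := T k) : _)) (u ⊓ T k).2.1
    simp [this]
  · field_simp
    ring

/-- Conditioning on the information of each source `k` up to the deterministic time `T k`: the
posterior only depends on the values at the times `T k`. -/
lemma lintegral_indicator_mul_stopped (T : ((α : Fin m) × Fin (n α)) → I) (hT : ∀ k, T k < 1)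
    {A : Set (Fin m → ℝ)} (hA : MeasurableSet A)
    {f : (((α : Fin m) × Fin (n α)) → I → ℝ) → ℝ≥0∞} (hf : Measurable f) :
    ∫⁻ ω, A.indicator 1 (M.vecX ω) * f (fun k u => M.info k.1 (u ⊓ T k) ω k.2) ∂P =
      ∫⁻ ω, M.jointPosterior (fun k => T k) (M.infoAt T ω) A *
        f (fun k u => M.info k.1 (u ⊓ T k) ω k.2) ∂P := by
  have hΦ : Measurable fun (q : (((α : Fin m) × Fin (n α)) → ℝ) ×
      (((α : Fin m) × Fin (n α)) → I → ℝ)) (k : (α : Fin m) × Fin (n α)) (u : I) =>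
        ((u ⊓ T k : I) : ℝ) / T k * q.1 k + M.vol k.1 k.2 * q.2 k u :=
    measurable_pi_lambda _ fun k => measurable_pi_lambda _ fun u =>
      (Measurable.const_mul (by fun_prop) _).add (Measurable.const_mul (by fun_prop) _)
  -- The stopped paths become a function of the values at T and of the residuals; the latter are
  -- independent of signal and noise and so leave the posterior unchanged.
  simp_rw [info_inf_eq]
  exact lintegral_indicator_mul_eq_bayes_of_indepFun (fun k => measurable_pi_apply k.1)
    (fun k => M.vol_pos k.1 k.2) (fun k => (T k).2.1) (fun k => hT k) (M.coe_noiseVar T)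
    M.measurable_vecX (M.measurable_noiseAt T) (M.measurable_residualAt T)
    (M.indepFun_vecX_noiseAt T) (M.map_noiseAt T) (M.indepFun_vecX_noiseAt_residualAt T) hA
    (hf.comp hΦ)

lemma jointPosterior_normalizer_ne_top (T : ((α : Fin m) × Fin (n α)) → I) (hT : ∀ k, T k < 1) :
    ∀ᵐ ω ∂P, ∫⁻ x, sourceLik (fun k x => x k.1) (fun k => M.vol k.1 k.2) (fun k => (T k : ℝ))
      (M.infoAt T ω) x ∂(P.map M.vecX) ≠ ∞ :=
  bayes_normalizer_ne_top (fun k => measurable_pi_apply k.1)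
    (fun k => M.vol_pos k.1 k.2) (fun k => (T k).2.1) (fun k => hT k) (M.coe_noiseVar T)
    M.measurable_vecX (M.measurable_noiseAt T) (M.indepFun_vecX_noiseAt T) (M.map_noiseAt T)

end InfoModel

/-! ### Decoupling the switching processes from the information processes -/

/-- The identity, viewed as a map to (Ω, 𝓐) and as a map to (Ω, 𝓑), gives two independent random
elements. This allows part of the randomness to be frozen without naming the variables that generate
it. -/
lemma ProbabilityTheory.Indep.lintegral_diag {Ω : Type*} {mΩ : MeasurableSpace Ω} {P : Measure Ω}
    [IsProbabilityMeasure P] {𝓐 𝓑 : MeasurableSpace Ω} (h : Indep 𝓐 𝓑 P) (h𝓐 : 𝓐 ≤ mΩ)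
    (h𝓑 : 𝓑 ≤ mΩ) {Ψ : Ω × Ω → ℝ≥0∞} (hΨ : Measurable[𝓐.prod 𝓑] Ψ) :
    ∫⁻ ω, Ψ (ω, ω) ∂P = ∫⁻ ω', ∫⁻ ω, Ψ (ω, ω') ∂P ∂P := by
  have h' : Indep (MeasurableSpace.comap id 𝓐) (MeasurableSpace.comap id 𝓑) P := by
    rwa [MeasurableSpace.comap_id, MeasurableSpace.comap_id]
  exact @IndepFun.lintegral_eq Ω Ω Ω mΩ 𝓐 𝓑 P _ id id h'
    (measurable_id'' h𝓐) (measurable_id'' h𝓑) Ψ hΨ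

section Decoupled

variable {Ω₁ Ω₂ κ S : Type*} {m₁ : MeasurableSpace Ω₁} {m₂ : MeasurableSpace Ω₂}
  {mS : MeasurableSpace S} {ξ : κ → I → Ω₁ → ℝ} {j : κ → I → Ω₂ → ℝ} {τ : κ → Ω₂ → I}

/-- Continuity of the paths in time gives joint measurability in time and sample point, so a random
time may be substituted. -/
lemma measurable_decoupled_info (hξc : ∀ k ω, Continuous fun u => ξ k u ω)
    (hξ : ∀ k u, Measurable (ξ k u)) (hτ : ∀ k, Measurable (τ k)) :
    Measurable fun (q : Ω₁ × Ω₂) k => ξ k (τ k q.2) q.1 :=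
  measurable_pi_lambda _ fun k =>
    (measurable_uncurry_of_continuous_of_measurable (hξc k) (hξ k)).comp
      (((hτ k).comp measurable_snd).prodMk measurable_fst)

lemma measurable_decoupled_obs (hξ : ∀ k u, Measurable (ξ k u)) (hj : ∀ k u, Measurable (j k u))
    (t : I) : Measurable fun q : Ω₁ × Ω₂ =>
      ((fun k u => j k (u ⊓ t) q.2 * ξ k (u ⊓ t) q.1 : κ → I → ℝ),
        (fun k u => j k (u ⊓ t) q.2 : κ → I → ℝ)) :=
  (measurable_pi_lambda _ fun k => measurable_pi_lambda _ fun _ =>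
    ((hj k _).comp measurable_snd).mul ((hξ k _).comp measurable_fst)).prodMk
  (measurable_pi_lambda _ fun k => measurable_pi_lambda _ fun _ => (hj k _).comp measurable_snd)

lemma measurable_decoupled_bayesPosterior [Fintype κ] {ν : Measure S} [SFinite ν]
    {p : κ → S → ℝ} {vol : κ → ℝ} (hp : ∀ k, Measurable (p k))
    (hξc : ∀ k ω, Continuous fun u => ξ k u ω)
    (hξ : ∀ k u, Measurable (ξ k u)) (hτ : ∀ k, Measurable (τ k)) {A : Set S}
    (hA : MeasurableSet A) : Measurable fun q : Ω₁ × Ω₂ => bayesPosterior ν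
      (sourceLik p vol (fun k => (τ k q.2 : ℝ)) fun k => ξ k (τ k q.2) q.1) A := by
  refine measurable_bayesPosterior_apply (w := fun q : Ω₁ × Ω₂ =>
      sourceLik p vol (fun k => (τ k q.2 : ℝ)) fun k => ξ k (τ k q.2) q.1)
    (Measurable.sourceLik hp ?_ ?_ measurable_snd) hA
  · exact measurable_pi_lambda _ fun k =>
      measurable_subtype_coe.comp ((hτ k).comp (measurable_snd.comp measurable_fst))
  · exact (measurable_decoupled_info hξc hξ hτ).comp measurable_fst

lemma measurable_decoupled_normalizer [Fintype κ] {ν : Measure S} [SFinite ν]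
    {p : κ → S → ℝ} {vol : κ → ℝ} (hp : ∀ k, Measurable (p k))
    (hξc : ∀ k ω, Continuous fun u => ξ k u ω)
    (hξ : ∀ k u, Measurable (ξ k u)) (hτ : ∀ k, Measurable (τ k)) :
    Measurable fun q : Ω₁ × Ω₂ => ∫⁻ x,
      sourceLik p vol (fun k => (τ k q.2 : ℝ)) (fun k => ξ k (τ k q.2) q.1) x ∂ν := by
  refine Measurable.lintegral_prod_right' (f := fun q : (Ω₁ × Ω₂) × S =>
      sourceLik p vol (fun k => (τ k q.1.2 : ℝ)) (fun k => ξ k (τ k q.1.2) q.1.1) q.2)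
    (Measurable.sourceLik hp ?_ ?_ measurable_snd)
  · exact measurable_pi_lambda _ fun k =>
      measurable_subtype_coe.comp ((hτ k).comp (measurable_snd.comp measurable_fst))
  · exact (measurable_decoupled_info hξc hξ hτ).comp measurable_fst

end Decoupled

/-! ### Last active times, and the independent σ-algebras of signal and switching -/

namespace InfoModel

variable {Ω : Type*} [mΩ : MeasurableSpace Ω] {P : Measure Ω} {m : ℕ} {n : Fin m → ℕ} {𝕏 : Set ℝ}
  (M : InfoModel P m n 𝕏)

lemma J_rightContinuous (α : Fin m) (i : Fin (n α)) (ω : Ω) (u : I) :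
    ContinuousWithinAt (fun u => M.J α u ω i) (Ici u) u :=
  continuousWithinAt_pi.1 (M.J_cadlag α ω u).1 i

lemma lastActive_le (α : Fin m) (i : Fin (n α)) (t : I) (ω : Ω) : M.lastActive α i t ω ≤ t :=
  sSup_le fun _ hu => hu.1

lemma le_lastActive {α : Fin m} {i : Fin (n α)} {t u : I} {ω : Ω} (hu : u ≤ t)
    (h : M.J α u ω i = 1) : u ≤ M.lastActive α i t ω :=
  le_sSup ⟨hu, h⟩

lemma lastActive_of_active {α : Fin m} {i : Fin (n α)} {t : I} {ω : Ω} (h : M.J α t ω i = 1) :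
    M.lastActive α i t ω = t :=
  le_antisymm (M.lastActive_le α i t ω) (M.le_lastActive le_rfl h)

/-- The σ-algebra of the factors and the bridges. -/
abbrev signalSigma : MeasurableSpace Ω :=
  MeasurableSpace.comap
    (fun ω => (M.vecX ω, fun (k : (α : Fin m) × Fin (n α)) (u : I) => M.β k.1 k.2 u ω)) inferInstance

/-- The σ-algebra of the switching processes. -/
abbrev switchSigma : MeasurableSpace Ω :=
  MeasurableSpace.comap (fun ω α (u : I) => M.J α u ω) inferInstance

lemma signalSigma_le : M.signalSigma ≤ mΩ :=
  comap_prodMk_le M.measurable_vecX.comap_le (comap_pi_le fun k => comap_pi_le fun u =>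
    ((M.bridge k.1 k.2).measurable u).comap_le)

lemma switchSigma_le : M.switchSigma ≤ mΩ :=
  (measurable_pi_lambda _ fun α => measurable_pi_lambda _ fun u => M.J_measurable α u).comap_le

lemma measurable_info_signalSigma (α : Fin m) (u : I) (i : Fin (n α)) :
    Measurable[M.signalSigma] fun ω => M.info α u ω i := by
  have h := comap_measurable (m := inferInstance)
    (fun ω => (M.vecX ω, fun (k : (α : Fin m) × Fin (n α)) (u : I) => M.β k.1 k.2 u ω))
  exact (((measurable_pi_apply α).comp (measurable_fst.comp h)).const_mul _).add
    (((measurable_pi_apply u).comp ((measurable_pi_apply ⟨α, i⟩).comp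
      (measurable_snd.comp h))).const_mul _)

lemma measurable_J_switchSigma (α : Fin m) (u : I) (i : Fin (n α)) :
    Measurable[M.switchSigma] fun ω => M.J α u ω i :=
  (measurable_pi_apply i).comp ((measurable_pi_apply u).comp ((measurable_pi_apply α).comp
    (comap_measurable (fun ω α (u : I) => M.J α u ω))))

lemma indep_signalSigma_switchSigma : Indep M.signalSigma M.switchSigma P := by
  have h := indep_iSup_of_disjoint M.sourceSigma_le M.indep
    (S := {i | ∀ α, i ≠ .inr (.inr α)}) (T := {i | ∃ α, i = .inr (.inr α)})
    (Set.disjoint_left.2 fun i hi ⟨α, hα⟩ => hi α hα)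
  refine indep_of_indep_of_le h ?_ ?_
  · refine comap_prodMk_le (comap_pi_le fun α => ?_) (comap_pi_le fun k => ?_)
    · exact le_iSup₂_of_le (Sum.inl α) (by simp) le_rfl
    · exact le_iSup₂_of_le (Sum.inr (Sum.inl k)) (by simp) le_rfl
  · exact comap_pi_le fun α => le_iSup₂_of_le (Sum.inr (Sum.inr α)) ⟨α, rfl⟩ le_rfl

/-! ### Bayes' formula for the natural filtration -/

/-- The space of pairs of paths: a modulated information path and a switching path. -/
abbrev ObsSpace {m : ℕ} (n : Fin m → ℕ) : Type :=
  (((α : Fin m) × Fin (n α)) → I → ℝ) × (((α : Fin m) × Fin (n α)) → I → ℝ)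

/-- The observations up to time `t`. -/
def observation (t : I) (ω : Ω) : ObsSpace n :=
  (fun k u => M.J k.1 (u ⊓ t) ω k.2 * M.info k.1 (u ⊓ t) ω k.2, fun k u => M.J k.1 (u ⊓ t) ω k.2)

lemma natSigma_le_comap_observation {t : I} (ht : t < 1) :
    M.natSigma t ≤ MeasurableSpace.comap (M.observation t) inferInstance := by
  have h := comap_measurable (m := inferInstance) (M.observation t)
  refine sup_le (iSup_le fun α => iSup₂_le fun u hu => sup_le ?_ ?_) ?_
  · refine comap_pi_le fun i => Measurable.comap_le ?_
    have h1 := (measurable_pi_apply u).comp ((measurable_pi_apply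
      (⟨α, i⟩ : (α : Fin m) × Fin (n α))).comp (measurable_fst.comp h))
    convert h1 using 1
    ext ω
    simp [observation, modulated, Matrix.mulVec_diagonal, inf_eq_left.2 hu]
  · refine comap_pi_le fun i => Measurable.comap_le ?_
    have h1 := (measurable_pi_apply u).comp ((measurable_pi_apply
      (⟨α, i⟩ : (α : Fin m) × Fin (n α))).comp (measurable_snd.comp h))
    convert h1 using 1
    ext ω
    simp [observation, inf_eq_left.2 hu]
  -- Before time 1 the term X 1_{t = 1} is constant and generates nothing.
  · have h0 : (fun ω => ({1} : Set I).indicator (fun _ => M.vecX ω) t) = fun _ => (0 : Fin m → ℝ) := by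
      ext1 ω
      simp [ht.ne]
    rw [h0, MeasurableSpace.comap_const]
    exact bot_le

lemma measurable_observation (t : I) : Measurable (M.observation t) :=
  (measurable_decoupled_obs (κ := (α : Fin m) × Fin (n α))
    (ξ := fun k u ω => M.info k.1 u ω k.2) (j := fun k u ω => M.J k.1 u ω k.2) (fun k u => M.measurable_info k.1 u k.2)
    (fun k u => (measurable_pi_apply k.2).comp (M.J_measurable k.1 u)) t).comp
    (measurable_id.prodMk measurable_id)

/-- A source only reveals its information up to its last active time. -/
lemma J_mul_info_eq (α : Fin m) (i : Fin (n α)) {t u : I} (hu : u ≤ t) (ω ω' : Ω) :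
    M.J α u ω' i * M.info α u ω i =
      M.J α u ω' i * M.info α (u ⊓ M.lastActive α i t ω') ω i := by
  rcases M.J_values α u ω' i with h | h
  · simp [h]
  · rw [inf_eq_left.2 (M.le_lastActive hu h)]

/-- The last times up to `t` at which the sources were active. -/
def lastTimes (t : I) (ω : Ω) (k : (α : Fin m) × Fin (n α)) : I := M.lastActive k.1 k.2 t ω

lemma lastTimes_lt_one {t : I} (ht : t < 1) (ω : Ω) (k : (α : Fin m) × Fin (n α)) :
    M.lastTimes t ω k < 1 :=
  (M.lastActive_le _ _ _ _).trans_lt ht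

/-- The joint likelihood of the observations up to time `t`. -/
def jointLik (t : I) (ω : Ω) : (Fin m → ℝ) → ℝ≥0∞ :=
  sourceLik (fun k x => x k.1) (fun k => M.vol k.1 k.2) (fun k => (M.lastTimes t ω k : ℝ))
    (M.infoAt (M.lastTimes t ω) ω)

/-- The posterior of the vector of factors given the observations up to time `t`. -/
def posteriorAt (t : I) (ω : Ω) : Measure (Fin m → ℝ) :=
  bayesPosterior (P.map M.vecX) (M.jointLik t ω)

lemma measurable_lastActive_switchSigma (α : Fin m) (i : Fin (n α)) (t : I) :
    Measurable[M.switchSigma] (M.lastActive α i t) :=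
  measurable_lastTime (fun u ω => M.J_values α u ω i) (fun ω u => M.J_rightContinuous α i ω u)
    fun u _ => M.measurable_J_switchSigma α u i

variable [IsProbabilityMeasure P]

/-- Independence replaces the switching path of ω by that of a second sample point ω', whose last
active times are constants for the integral in ω. Bayes' formula at deterministic times applies
there, and the same decoupling is then undone. -/
theorem measure_inter_eq_lintegral_posteriorAt {t : I} (ht : t < 1) {A : Set (Fin m → ℝ)}
    (hA : MeasurableSet A) {H : Set Ω} (hH : MeasurableSet[M.natSigma t] H) :
    P (M.vecX ⁻¹' A ∩ H) = ∫⁻ ω in H, M.posteriorAt t ω A ∂P := by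
  have : IsProbabilityMeasure (P.map M.vecX) :=
    Measure.isProbabilityMeasure_map M.measurable_vecX.aemeasurable
  obtain ⟨B, hB, rfl⟩ := M.natSigma_le_comap_observation ht _ hH
  have hHm : MeasurableSet (M.observation t ⁻¹' B) := M.measurable_observation t hB
  have hXm : MeasurableSet (M.vecX ⁻¹' A) := M.measurable_vecX hA
  let D : Ω × Ω → ObsSpace n :=
    fun q => (fun k u => M.J k.1 (u ⊓ t) q.2 k.2 * M.info k.1 (u ⊓ t) q.1 k.2,
      fun k u => M.J k.1 (u ⊓ t) q.2 k.2)
  have hD : Measurable[M.signalSigma.prod M.switchSigma] D :=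
    measurable_decoupled_obs (κ := (α : Fin m) × Fin (n α))
    (ξ := fun k u ω => M.info k.1 u ω k.2) (j := fun k u ω => M.J k.1 u ω k.2) (fun k u => M.measurable_info_signalSigma k.1 u k.2)
      (fun k u => M.measurable_J_switchSigma k.1 u k.2) t
  have hDB : Measurable[M.signalSigma.prod M.switchSigma] fun q =>
      B.indicator (1 : ObsSpace n → ℝ≥0∞) (D q) :=
    (measurable_one.indicator hB).comp hD
  have hX : Measurable[M.signalSigma.prod M.switchSigma] fun q : Ω × Ω =>
      A.indicator (1 : (Fin m → ℝ) → ℝ≥0∞) (M.vecX q.1) :=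
    (measurable_one.indicator hA).comp ((measurable_fst.comp (comap_measurable (m := inferInstance) (fun ω =>
      (M.vecX ω, fun (k : (α : Fin m) × Fin (n α)) (u : I) => M.β k.1 k.2 u ω)))).comp
      measurable_fst)
  have hpost : Measurable[M.signalSigma.prod M.switchSigma] fun q : Ω × Ω =>
      M.jointPosterior (fun k => (M.lastTimes t q.2 k : ℝ)) (M.infoAt (M.lastTimes t q.2) q.1) A :=
    measurable_decoupled_bayesPosterior (κ := (α : Fin m) × Fin (n α))
      (ξ := fun k u ω => M.info k.1 u ω k.2) (fun k => measurable_pi_apply k.1)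
      (fun k ω => M.continuous_info k.1 ω k.2)
      (fun k u => M.measurable_info_signalSigma k.1 u k.2)
      (fun k => M.measurable_lastActive_switchSigma k.1 k.2 t) hA
  have h1 := M.indep_signalSigma_switchSigma.lintegral_diag M.signalSigma_le M.switchSigma_le
    (hX.mul hDB)
  have h2 := M.indep_signalSigma_switchSigma.lintegral_diag M.signalSigma_le M.switchSigma_le
    (hpost.mul hDB)
  calc P (M.vecX ⁻¹' A ∩ M.observation t ⁻¹' B)
      = ∫⁻ ω, A.indicator (1 : (Fin m → ℝ) → ℝ≥0∞) (M.vecX ω) *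
          B.indicator (1 : ObsSpace n → ℝ≥0∞) (D (ω, ω)) ∂P := by
        rw [← lintegral_indicator_one (hXm.inter hHm)]
        refine lintegral_congr fun ω => ?_
        rw [Set.inter_indicator_one]
        rfl
    _ = ∫⁻ ω', ∫⁻ ω, A.indicator (1 : (Fin m → ℝ) → ℝ≥0∞) (M.vecX ω) *
          B.indicator (1 : ObsSpace n → ℝ≥0∞) (D (ω, ω')) ∂P ∂P := h1
    _ = ∫⁻ ω', ∫⁻ ω, M.jointPosterior (fun k => (M.lastTimes t ω' k : ℝ))
          (M.infoAt (M.lastTimes t ω') ω) A * B.indicator (1 : ObsSpace n → ℝ≥0∞) (D (ω, ω')) ∂P ∂P := by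
        refine lintegral_congr fun ω' => ?_
        -- The frozen observation depends only on the information paths stopped at the last active
        -- times of ω'.
        have hD' : ∀ ω, D (ω, ω') =
            (fun k u => M.J k.1 (u ⊓ t) ω' k.2 * M.info k.1 ((u ⊓ t) ⊓ M.lastTimes t ω' k) ω k.2,
              fun k u => M.J k.1 (u ⊓ t) ω' k.2) := fun ω => by
          simp only [D, Prod.mk.injEq, and_true]
          ext k u
          exact M.J_mul_info_eq k.1 k.2 inf_le_right ω ω'
        simp_rw [hD']
        refine M.lintegral_indicator_mul_stopped (M.lastTimes t ω')
          (M.lastTimes_lt_one ht ω') hA (f := fun g => B.indicator (1 : ObsSpace n → ℝ≥0∞)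
            ((fun k u => M.J k.1 (u ⊓ t) ω' k.2 * g k (u ⊓ t)),
              fun k u => M.J k.1 (u ⊓ t) ω' k.2)) ?_
        refine (measurable_one.indicator hB).comp (Measurable.prodMk ?_ measurable_const)
        exact measurable_pi_lambda _ fun k => measurable_pi_lambda _ fun u =>
          Measurable.const_mul (by fun_prop) _
    _ = ∫⁻ ω, M.posteriorAt t ω A * B.indicator (1 : ObsSpace n → ℝ≥0∞) (D (ω, ω)) ∂P := h2.symm
    _ = ∫⁻ ω in M.observation t ⁻¹' B, M.posteriorAt t ω A ∂P := by
        rw [← lintegral_indicator hHm]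
        refine lintegral_congr fun ω => ?_
        by_cases hω : M.observation t ω ∈ B
        · have h : D (ω, ω) ∈ B := hω
          simp [h, hω]
        · have h : D (ω, ω) ∉ B := hω
          simp [h, hω]

/-- For each frozen switching path the exceptional set is null by the deterministic case;
independence carries this over to the diagonal. -/
lemma lintegral_jointLik_ne_top {t : I} (ht : t < 1) :
    ∀ᵐ ω ∂P, ∫⁻ x, M.jointLik t ω x ∂(P.map M.vecX) ≠ ∞ := by
  have : IsProbabilityMeasure (P.map M.vecX) :=
    Measure.isProbabilityMeasure_map M.measurable_vecX.aemeasurable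
  obtain ⟨Z, hZ⟩ : ∃ Z : Ω × Ω → ℝ≥0∞, Z = fun q => ∫⁻ x,
      sourceLik (fun k x => x k.1) (fun k => M.vol k.1 k.2)
        (fun k => (M.lastTimes t q.2 k : ℝ)) (M.infoAt (M.lastTimes t q.2) q.1) x
        ∂(P.map M.vecX) := ⟨_, rfl⟩
  have hZm : Measurable[M.signalSigma.prod M.switchSigma] Z := by
    rw [hZ]
    exact measurable_decoupled_normalizer (κ := (α : Fin m) × Fin (n α))
      (ξ := fun k u ω => M.info k.1 u ω k.2) (fun k => measurable_pi_apply k.1)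
      (fun k ω => M.continuous_info k.1 ω k.2)
      (fun k u => M.measurable_info_signalSigma k.1 u k.2)
      (fun k => M.measurable_lastActive_switchSigma k.1 k.2 t)
  have h1 : Measurable (({∞} : Set ℝ≥0∞).indicator (1 : ℝ≥0∞ → ℝ≥0∞)) :=
    measurable_one.indicator (measurableSet_singleton ∞)
  have h := M.indep_signalSigma_switchSigma.lintegral_diag M.signalSigma_le M.switchSigma_le
    (Ψ := fun q => ({∞} : Set ℝ≥0∞).indicator (1 : ℝ≥0∞ → ℝ≥0∞) (Z q)) (h1.comp hZm)
  have h0 : ∀ ω', ∫⁻ ω, ({∞} : Set ℝ≥0∞).indicator (1 : ℝ≥0∞ → ℝ≥0∞) (Z (ω, ω')) ∂P = 0 :=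
    fun ω' => by
      rw [← lintegral_zero (α := Ω) (μ := P)]
      refine lintegral_congr_ae ?_
      filter_upwards [M.jointPosterior_normalizer_ne_top (M.lastTimes t ω')
        (M.lastTimes_lt_one ht ω')] with ω hω
      rw [hZ]
      rw [Set.indicator_of_notMem]
      exact hω
  simp_rw [h0, lintegral_zero] at h
  have hm : Measurable fun ω => Z (ω, ω) :=
    hZm.comp ((measurable_id'' M.signalSigma_le).prodMk (measurable_id'' M.switchSigma_le))
  filter_upwards [(lintegral_eq_zero_iff (h1.comp hm)).1 h] with ω hω htop
  have h2 : Z (ω, ω) = ∞ := by rw [hZ]; exact htop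
  simp [h2] at hω

end InfoModel

namespace InfoModel

variable {Ω : Type*} [mΩ : MeasurableSpace Ω] {P : Measure Ω} {m : ℕ} {n : Fin m → ℕ} {𝕏 : Set ℝ}
  (M : InfoModel P m n 𝕏)

/-! ### The factorwise posteriors -/

lemma inactive_eq (α : Fin m) (t : I) (ω : Ω) :
    M.inactive α t ω = Finset.univ.filter fun i => ¬M.J α t ω i = 1 := by
  refine Finset.filter_congr fun i _ => ?_
  rcases M.J_values α t ω i with h | h <;> simp [h]

/-- The effective likelihood is the product of the likelihoods of all sources at their last active
times. -/
lemma effWeight_eq_prod (α : Fin m) (t : I) (ω : Ω) (x : ℝ) :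
    M.effWeight α t ω x = ∏ i, gaussH x (M.info α (M.lastActive α i t ω) ω i)
      (M.lastActive α i t ω) (M.vol α i) := by
  rw [effWeight, compInfo, inactive_eq, ← Finset.prod_filter_mul_prod_filter_not Finset.univ
    (fun i => M.J α t ω i = 1)]
  congr 1
  have h1 : ∏ i with M.J α t ω i = 1, gaussH x (M.info α (M.lastActive α i t ω) ω i)
      (M.lastActive α i t ω) (M.vol α i) =
      ∏ i ∈ M.active α t ω, gaussH x (M.info α t ω i) t (M.vol α i) := by
    refine Finset.prod_congr rfl fun i hi => ?_
    rw [M.lastActive_of_active (Finset.mem_filter.1 hi).2]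
  rw [h1, effInfo, effVol]
  -- With no active source the product is empty and `effVol` is 0, where `gaussH` is 1 by
  -- convention.
  by_cases hA : M.active α t ω = ∅
  · simp [hA, gaussH]
  · simp only [hA, if_false]
    have hpos : 0 < ∑ i ∈ M.active α t ω, (M.vol α i ^ 2)⁻¹ :=
      Finset.sum_pos (fun i _ => inv_pos.2 (pow_pos (M.vol_pos α i) 2))
        (Finset.nonempty_iff_ne_empty.2 hA)
    have hsq : ((Real.sqrt (∑ i ∈ M.active α t ω, (M.vol α i ^ 2)⁻¹))⁻¹) ^ 2 =
        (∑ i ∈ M.active α t ω, (M.vol α i ^ 2)⁻¹)⁻¹ := by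
      rw [inv_pow, Real.sq_sqrt hpos.le]
    have hne : (Real.sqrt (∑ i ∈ M.active α t ω, (M.vol α i ^ 2)⁻¹))⁻¹ ≠ 0 :=
      inv_ne_zero (Real.sqrt_pos.2 hpos).ne'
    simp only [gaussH, hne, if_false, hsq, (M.vol_pos α _).ne']
    rw [← Real.exp_sum]
    congr 1
    set s := ∑ i ∈ M.active α t ω, (M.vol α i ^ 2)⁻¹ with hs
    -- Each exponent is linear in the precision vol⁻² and in the weighted information vol⁻² ξ, so
    -- the sum involves only the total precision `s` and the weighted sum of informations.
    have h2 : ∀ i, (x * M.info α t ω i - t * x ^ 2 / 2) / (M.vol α i ^ 2 * (1 - t)) =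
        (x / (1 - t)) * ((M.vol α i ^ 2)⁻¹ * M.info α t ω i) -
          (t * x ^ 2 / 2 / (1 - t)) * (M.vol α i ^ 2)⁻¹ := fun i => by
      rw [div_eq_mul_inv, mul_inv, div_eq_mul_inv, div_eq_mul_inv _ (1 - (t : ℝ))]
      ring
    simp_rw [h2]
    rw [Finset.sum_sub_distrib, ← Finset.mul_sum, ← Finset.mul_sum, ← hs, div_eq_mul_inv, mul_inv,
      inv_inv, div_eq_mul_inv, div_eq_mul_inv _ (1 - (t : ℝ))]
    field_simp

lemma effWeight_pos (α : Fin m) (t : I) (ω : Ω) (x : ℝ) : 0 < M.effWeight α t ω x := by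
  rw [effWeight_eq_prod]
  exact Finset.prod_pos fun i _ => gaussH_pos _ _ _ _

lemma continuous_effWeight (α : Fin m) (t : I) (ω : Ω) : Continuous (M.effWeight α t ω) := by
  simp_rw [funext (M.effWeight_eq_prod α t ω)]
  exact continuous_finsetProd _ fun i _ => continuous_gaussH_left _ _ _

lemma jointLik_eq (t : I) (ω : Ω) (x : Fin m → ℝ) :
    M.jointLik t ω x = ∏ α, ENNReal.ofReal (M.effWeight α t ω (x α)) := by
  simp_rw [effWeight_eq_prod, ENNReal.ofReal_prod_of_nonneg fun _ _ => (gaussH_pos _ _ _ _).le]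
  rw [jointLik, sourceLik, Fintype.prod_sigma]
  rfl

lemma map_vecX : P.map M.vecX = Measure.pi M.law := by
  have h : iIndepFun M.X P := M.indep.precomp Sum.inl_injective
  exact h.map_fun_eq_pi_map fun α => (M.X_measurable α).aemeasurable

variable [IsProbabilityMeasure P]

instance (α : Fin m) : IsProbabilityMeasure (M.law α) :=
  Measure.isProbabilityMeasure_map (M.X_measurable α).aemeasurable

instance : IsProbabilityMeasure (P.map M.vecX) :=
  Measure.isProbabilityMeasure_map M.measurable_vecX.aemeasurable

/-- Prior and likelihood are both products over the factors, and finiteness of the joint normaliser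
forces that of each factor's normaliser. -/
lemma posterior_factorizes {t : I} (ht : t < 1) :
    ∀ᵐ ω ∂P, (∀ α, IsProbabilityMeasure (M.posterior α t ω)) ∧
      M.posteriorAt t ω = Measure.pi fun α => M.posterior α t ω := by
  filter_upwards [M.lintegral_jointLik_ne_top ht] with ω hω
  have hm : ∀ α, Measurable fun x => ENNReal.ofReal (M.effWeight α t ω x) := fun α =>
    (M.continuous_effWeight α t ω).measurable.ennreal_ofReal
  have hpos : ∀ α x, 0 < ENNReal.ofReal (M.effWeight α t ω x) := fun α x =>
    ENNReal.ofReal_pos.2 (M.effWeight_pos α t ω x)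
  simp_rw [posteriorAt, funext (M.jointLik_eq t ω), map_vecX] at hω ⊢
  obtain ⟨h1, h2⟩ := bayesPosterior_pi M.law hm hpos hω
  exact ⟨fun α => isProbabilityMeasure_bayesPosterior
    (lintegral_ne_zero_of_pos (hm α) (hpos α)) (h1 α), h2⟩

lemma posterior_apply_ae {t : I} (ht : t < 1) (α : Fin m) {A : Set ℝ} (hA : MeasurableSet A) :
    ∀ᵐ ω ∂P, M.posterior α t ω A = M.posteriorAt t ω ((fun x : Fin m → ℝ => x α) ⁻¹' A) := by
  filter_upwards [M.posterior_factorizes ht] with ω ⟨h1, h2⟩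
  rw [h2, (measurePreserving_eval (fun α => M.posterior α t ω) α).measure_preimage
    hA.nullMeasurableSet]

/-! ### Measurability with respect to the natural filtration -/

omit [IsProbabilityMeasure P] in
lemma measurable_J_natSigma {t u : I} (hu : u ≤ t) (α : Fin m) (i : Fin (n α)) :
    Measurable[M.natSigma t] fun ω => M.J α u ω i := by
  have h : MeasurableSpace.comap (M.J α u) inferInstance ≤ M.natSigma t :=
    le_sup_of_le_left (le_iSup_of_le α (le_iSup₂_of_le u hu le_sup_right))
  exact (measurable_pi_apply i).comp ((comap_measurable (M.J α u)).mono h le_rfl)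

omit [IsProbabilityMeasure P] in
lemma measurable_J_mul_info_natSigma {t u : I} (hu : u ≤ t) (α : Fin m) (i : Fin (n α)) :
    Measurable[M.natSigma t] fun ω => M.J α u ω i * M.info α u ω i := by
  have h : MeasurableSpace.comap (M.modulated α u) inferInstance ≤ M.natSigma t :=
    le_sup_of_le_left (le_iSup_of_le α (le_iSup₂_of_le u hu le_sup_left))
  have h1 := (measurable_pi_apply i).comp ((comap_measurable (M.modulated α u)).mono h le_rfl)
  convert h1 using 1
  ext ω
  simp [modulated, Matrix.mulVec_diagonal]

omit [IsProbabilityMeasure P] in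
lemma measurable_lastActive_natSigma (t : I) (α : Fin m) (i : Fin (n α)) :
    Measurable[M.natSigma t] (M.lastActive α i t) :=
  measurable_lastTime (fun u ω => M.J_values α u ω i) (fun ω u => M.J_rightContinuous α i ω u)
    fun _ hu => M.measurable_J_natSigma hu α i

open Classical in
/-- The last revealed information of each source (`0` if the source has not been active). -/
def revealedInfo (t : I) (α : Fin m) (ω : Ω) (i : Fin (n α)) : ℝ :=
  if {u | u ≤ t ∧ M.J α u ω i = 1}.Nonempty then M.info α (M.lastActive α i t ω) ω i else 0

omit [IsProbabilityMeasure P] in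
lemma measurable_revealedInfo (t : I) (α : Fin m) (i : Fin (n α)) :
    Measurable[M.natSigma t] fun ω => M.revealedInfo t α ω i :=
  measurable_valueAtLastTime (j := fun u ω => M.J α u ω i) (g := fun u ω => M.info α u ω i)
    (fun u ω => M.J_values α u ω i) (fun ω u => M.J_rightContinuous α i ω u)
    (fun ω => M.continuous_info α ω i) (fun _ hu => M.measurable_J_natSigma hu α i)
    fun _ hu => M.measurable_J_mul_info_natSigma hu α i

omit [IsProbabilityMeasure P] in
-- For a source that has never been active the last active time is 0 by convention. The value there
-- is not observed, but it vanishes almost surely because β_0 has variance 0.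
lemma revealedInfo_ae (t : I) :
    ∀ᵐ ω ∂P, ∀ α i, M.revealedInfo t α ω i = M.info α (M.lastActive α i t ω) ω i := by
  filter_upwards [M.info_zero_ae] with ω hω α i
  unfold revealedInfo
  split_ifs with h
  · rfl
  · have : M.lastActive α i t ω = 0 := by
      rw [lastActive, Set.not_nonempty_iff_eq_empty.1 h, sSup_empty]
      rfl
    rw [this, hω]

omit [IsProbabilityMeasure P] in
lemma natSigma_le (t : I) : M.natSigma t ≤ mΩ := by
  refine sup_le (iSup_le fun α => iSup₂_le fun u _ => sup_le ?_ ?_) ?_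
  · refine comap_pi_le fun i => Measurable.comap_le ?_
    have h := ((measurable_pi_apply i).comp (M.J_measurable α u)).mul (M.measurable_info α u i)
    convert h using 1
    ext ω
    simp [modulated, Matrix.mulVec_diagonal]
  · exact (M.J_measurable α u).comap_le
  · refine Measurable.comap_le ?_
    by_cases h : t ∈ ({1} : Set I)
    · simp only [Set.indicator_of_mem h]
      exact M.measurable_vecX
    · simp only [Set.indicator_of_notMem h]
      exact measurable_const

lemma aestronglyMeasurable_posteriorAt (t : I) {A : Set (Fin m → ℝ)} (hA : MeasurableSet A) :
    AEStronglyMeasurable[M.natSigma t] (fun ω => (M.posteriorAt t ω).real A) P := by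
  have hT : Measurable[M.natSigma t] fun ω (k : (α : Fin m) × Fin (n α)) =>
      (M.lastTimes t ω k : ℝ) :=
    measurable_iff_comap_le.2 <| comap_pi_le fun k =>
      (measurable_subtype_coe.comp (M.measurable_lastActive_natSigma t k.1 k.2)).comap_le
  have hy : Measurable[M.natSigma t] fun ω (k : (α : Fin m) × Fin (n α)) =>
      M.revealedInfo t k.1 ω k.2 :=
    measurable_iff_comap_le.2 <| comap_pi_le fun k =>
      (M.measurable_revealedInfo t k.1 k.2).comap_le
  have hw := Measurable.sourceLik (p := fun (k : (α : Fin m) × Fin (n α)) (x : Fin m → ℝ) => x k.1)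
    (vol := fun k => M.vol k.1 k.2) (fun k => measurable_pi_apply k.1)
    (hT.comp measurable_fst) (hy.comp measurable_fst) measurable_snd
  have h1 := measurable_bayesPosterior_apply (ν := P.map M.vecX) (w := fun ω => sourceLik
    (fun (k : (α : Fin m) × Fin (n α)) (x : Fin m → ℝ) => x k.1) (fun k => M.vol k.1 k.2)
    (fun k => (M.lastTimes t ω k : ℝ)) fun k => M.revealedInfo t k.1 ω k.2) hw hA
  refine ⟨_, h1.ennreal_toReal.stronglyMeasurable, ?_⟩
  filter_upwards [M.revealedInfo_ae t] with ω hω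
  have : M.infoAt (M.lastTimes t ω) ω = fun k => M.revealedInfo t k.1 ω k.2 := by
    ext k
    exact (hω k.1 k.2).symm
  rw [posteriorAt, jointLik, this, measureReal_def]

/-- The effective and complementary observations as a function of the present switching state, the
last active times and the last revealed information. -/
def effObsOf (α : Fin m) (j τ y : Fin (n α) → ℝ) : (ℝ × ℝ) × (𝕏 → ℝ) :=
  let v := (Real.sqrt (∑ i, if j i = 1 then (M.vol α i ^ 2)⁻¹ else 0))⁻¹
  ((v ^ 2 * ∑ i, if j i = 1 then (M.vol α i ^ 2)⁻¹ * y i else 0, v),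
    fun x => ∏ i, if j i = 0 then gaussH x (y i) (τ i) (M.vol α i) else 1)

omit [IsProbabilityMeasure P] in
lemma measurable_effObsOf {𝓐 : MeasurableSpace Ω} (α : Fin m) {j τ y : Ω → Fin (n α) → ℝ}
    (hj : ∀ i, Measurable[𝓐] fun ω => j ω i) (hτ : ∀ i, Measurable[𝓐] fun ω => τ ω i)
    (hy : ∀ i, Measurable[𝓐] fun ω => y ω i) :
    Measurable[𝓐] fun ω => @effObsOf Ω mΩ P m n 𝕏 M α (j ω) (τ ω) (y ω) := by
  have h1 : ∀ i, MeasurableSet[𝓐] {ω | j ω i = 1} := fun i => hj i (measurableSet_singleton 1)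
  have h0 : ∀ i, MeasurableSet[𝓐] {ω | j ω i = 0} := fun i => hj i (measurableSet_singleton 0)
  have hv : Measurable[𝓐] fun ω =>
      (Real.sqrt (∑ i, if j ω i = 1 then (@vol Ω mΩ P m n 𝕏 M α i ^ 2)⁻¹ else 0))⁻¹ :=
    (Finset.measurable_sum _ fun i _ =>
      Measurable.ite (h1 i) measurable_const measurable_const).sqrt.inv
  refine Measurable.prodMk (Measurable.prodMk ((hv.pow_const 2).mul
    (Finset.measurable_sum _ fun i _ => Measurable.ite (h1 i) ((hy i).const_mul _)
      measurable_const)) hv) (measurable_pi_lambda _ fun x => ?_)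
  exact Finset.measurable_prod _ fun i _ => Measurable.ite (h0 i)
    (measurable_const.gaussH (hy i) (hτ i) measurable_const) measurable_const

omit [IsProbabilityMeasure P] in
lemma effCompObs_eq (α : Fin m) (t : I) (ω : Ω) :
    M.effCompObs α t ω = M.effObsOf α (M.J α t ω) (fun i => (M.lastActive α i t ω : ℝ))
      (fun i => M.info α (M.lastActive α i t ω) ω i) := by
  have hv : M.effVol α t ω =
      (Real.sqrt (∑ i, if M.J α t ω i = 1 then (M.vol α i ^ 2)⁻¹ else 0))⁻¹ := by
    rw [effVol, ← Finset.sum_filter]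
    split_ifs with h
    -- The empty sum gives (√0)⁻¹ = 0, in agreement with the convention for `effVol`.
    · have h' : (Finset.univ.filter fun i => M.J α t ω i = 1) = ∅ := h
      simp [h']
    · rfl
  simp only [effCompObs, effObsOf, Prod.mk.injEq, effInfo, hv, and_true]
  constructor
  · rw [active, Finset.sum_filter]
    congr 1
    refine Finset.sum_congr rfl fun i _ => ?_
    split_ifs with h
    · rw [M.lastActive_of_active h]
    · rfl
  · ext x
    rw [compInfo, inactive, Finset.prod_filter]

omit [IsProbabilityMeasure P] in
lemma measurable_effCompObs (α : Fin m) (t : I) : Measurable (M.effCompObs α t) := by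
  simp_rw [funext (M.effCompObs_eq α t)]
  have hτ : ∀ i, Measurable (M.lastActive α i t) := fun i =>
    (M.measurable_lastActive_natSigma t α i).mono (M.natSigma_le t) le_rfl
  refine M.measurable_effObsOf α (fun i => (measurable_pi_apply i).comp (M.J_measurable α t))
    (fun i => measurable_subtype_coe.comp (hτ i)) fun i => ?_
  exact (measurable_uncurry_of_continuous_of_measurable (u := fun u ω => M.info α u ω i)
    (fun ω => M.continuous_info α ω i) fun u => M.measurable_info α u i).comp
      ((hτ i).prodMk measurable_id)

omit [IsProbabilityMeasure P] in
/-- Up to a null set, the effective and complementary observations are measurable with respect to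
the natural filtration. -/
lemma exists_natSigma_measurable_effCompObs (α : Fin m) (t : I) :
    ∃ O : Ω → (ℝ × ℝ) × (𝕏 → ℝ), Measurable[M.natSigma t] O ∧ M.effCompObs α t =ᵐ[P] O := by
  refine ⟨fun ω => M.effObsOf α (M.J α t ω) (fun i => (M.lastActive α i t ω : ℝ))
    (M.revealedInfo t α ω), ?_, ?_⟩
  · exact M.measurable_effObsOf α (fun i => M.measurable_J_natSigma le_rfl α i)
      (fun i => measurable_subtype_coe.comp (M.measurable_lastActive_natSigma t α i))
      fun i => M.measurable_revealedInfo t α i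
  · filter_upwards [M.revealedInfo_ae t] with ω hω
    rw [effCompObs_eq]
    congr 1
    ext i
    exact (hω α i).symm

end InfoModel

namespace InfoModel

variable {Ω : Type*} [mΩ : MeasurableSpace Ω] {P : Measure Ω} {m : ℕ} {n : Fin m → ℕ} {𝕏 : Set ℝ}
  (M : InfoModel P m n 𝕏)

/-! ### The right-continuous completed filtration -/

lemma complSigma_le (t : I) : M.complSigma t ≤ mΩ :=
  sup_le (M.natSigma_le t) (MeasurableSpace.generateFrom_le fun _ h => h.1)

lemma augSigma_le {t : I} (ht : t < 1) : M.augSigma t ≤ mΩ :=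
  (iInf₂_le 1 ht).trans (M.complSigma_le 1)

lemma natSigma_le_augSigma {t : I} : M.natSigma t ≤ M.augSigma t := by
  refine le_iInf₂ fun s hs => le_sup_of_le_left ?_
  refine sup_le (iSup_le fun α => iSup₂_le fun u hu => ?_) ?_
  · exact le_sup_of_le_left (le_iSup_of_le α (le_iSup₂_of_le u (hu.trans hs.le) le_rfl))
  · have h0 : (fun ω => ({1} : Set I).indicator (fun _ => M.vecX ω) t) =
        fun _ => (0 : Fin m → ℝ) := by
      ext1 ω
      simp [(hs.trans_le unitInterval.le_one').ne]
    rw [h0, MeasurableSpace.comap_const]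
    exact bot_le

/-- The sets almost everywhere equal to a member of `natSigma t` form a σ-algebra, and it contains
the null sets. -/
lemma exists_natSigma_ae_eq {t : I} {H : Set Ω} (hH : MeasurableSet[M.complSigma t] H) :
    ∃ H', MeasurableSet[M.natSigma t] H' ∧ H =ᵐ[P] H' := by
  have h : M.complSigma t ≤ @eventuallyMeasurableSpace Ω (M.natSigma t) (ae P) _ := by
    refine sup_le (@le_eventuallyMeasurableSpace Ω (M.natSigma t) (ae P) _)
      (MeasurableSpace.generateFrom_le fun N hN => ?_)
    exact ⟨∅, @MeasurableSet.empty _ (M.natSigma t), ae_eq_empty.2 hN.2⟩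
  exact h _ hH

lemma measurable_posteriorAt [IsProbabilityMeasure P] (t : I) {A : Set (Fin m → ℝ)}
    (hA : MeasurableSet A) : Measurable fun ω => M.posteriorAt t ω A := by
  have hτ : ∀ k : (α : Fin m) × Fin (n α), Measurable (M.lastActive k.1 k.2 t) := fun k =>
    (M.measurable_lastActive_natSigma t k.1 k.2).mono (M.natSigma_le t) le_rfl
  have hT : Measurable fun ω (k : (α : Fin m) × Fin (n α)) => (M.lastTimes t ω k : ℝ) :=
    measurable_pi_lambda _ fun k => measurable_subtype_coe.comp (hτ k)
  have hy : Measurable fun ω => M.infoAt (M.lastTimes t ω) ω :=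
    (measurable_decoupled_info (κ := (α : Fin m) × Fin (n α))
      (ξ := fun k u ω => M.info k.1 u ω k.2) (fun k ω => M.continuous_info k.1 ω k.2)
      (fun k u => M.measurable_info k.1 u k.2) hτ).comp (measurable_id.prodMk measurable_id)
  have hw := Measurable.sourceLik (p := fun (k : (α : Fin m) × Fin (n α)) (x : Fin m → ℝ) => x k.1)
    (vol := fun k => M.vol k.1 k.2) (fun k => measurable_pi_apply k.1)
    (hT.comp measurable_fst) (hy.comp measurable_fst) measurable_snd
  exact measurable_bayesPosterior_apply (w := M.jointLik t) hw hA

/-- By right-continuity a source keeps its state at t for a short while. If inactive, its last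
active time does not move; if active, its last active time at s is s itself, which tends to t. -/
lemma tendsto_lastActive {α : Fin m} {i : Fin (n α)} {t : I} (ω : Ω) {s : ℕ → I}
    (hs : ∀ k, t < s k) (hlim : Tendsto s atTop (𝓝 t)) :
    Tendsto (fun k => M.lastActive α i (s k) ω) atTop (𝓝 (M.lastActive α i t ω)) := by
  have hs' : Tendsto s atTop (𝓝[≥] t) :=
    tendsto_nhdsWithin_iff.2 ⟨hlim, Eventually.of_forall fun k => (hs k).le⟩
  have hJ := M.J_rightContinuous α i ω t
  rcases M.J_values α t ω i with h | h
  · have h1 : {u | M.J α u ω i < 1} ∈ 𝓝[≥] t :=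
      hJ (Iio_mem_nhds (by simp [h]))
    obtain ⟨w, hw, hsub⟩ := (mem_nhdsGE_iff_exists_Ico_subset' (hs 0)).1 h1
    refine tendsto_const_nhds.congr' ?_
    filter_upwards [hlim (Iio_mem_nhds hw)] with k hk
    unfold lastActive
    congr 1
    ext u
    refine ⟨fun hu => ⟨hu.1.trans (hs k).le, hu.2⟩, fun hu => ⟨?_, hu.2⟩⟩
    by_contra hut
    exact (hsub ⟨(not_le.1 hut).le, hu.1.trans_lt hk⟩ : M.J α u ω i < 1).ne hu.2
  · have h1 : {u | 0 < M.J α u ω i} ∈ 𝓝[≥] t :=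
      hJ (Ioi_mem_nhds (by simp [h]))
    rw [M.lastActive_of_active h]
    refine hlim.congr' ?_
    filter_upwards [hs' h1] with k hk
    exact (M.lastActive_of_active ((M.J_values α (s k) ω i).resolve_left (ne_of_gt hk))).symm

lemma tendsto_jointLik {t : I} (ht : t < 1) (ω : Ω) {s : ℕ → I}
    (hs : ∀ k, t < s k) (hlim : Tendsto s atTop (𝓝 t)) (x : Fin m → ℝ) :
    Tendsto (fun k => M.jointLik (s k) ω x) atTop (𝓝 (M.jointLik t ω x)) := by
  simp_rw [jointLik, sourceLik, ← ENNReal.ofReal_prod_of_nonneg fun _ _ => (gaussH_pos _ _ _ _).le]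
  refine (ENNReal.continuous_ofReal.tendsto _).comp (tendsto_finsetProd _ fun k _ => ?_)
  have hτ := M.tendsto_lastActive (α := k.1) (i := k.2) ω hs hlim
  have hy := ((M.continuous_info k.1 ω k.2).tendsto _).comp hτ
  have hT := (continuous_subtype_val.tendsto _).comp hτ
  have h1 : (1 : ℝ) - M.lastActive k.1 k.2 t ω ≠ 0 :=
    (sub_pos.2 (show (M.lastActive k.1 k.2 t ω : ℝ) < 1 from M.lastTimes_lt_one ht ω k)).ne'
  simp only [gaussH, (M.vol_pos k.1 k.2).ne', if_false]
  refine (Real.continuous_exp.tendsto _).comp (Tendsto.div ?_ ?_ (mul_ne_zero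
    (pow_ne_zero 2 (M.vol_pos k.1 k.2).ne') h1))
  · exact (hy.const_mul _).sub ((hT.mul_const _).div_const _)
  · exact (hT.const_sub 1).const_mul _

/-- On a bounded set, the likelihoods up to times bounded away from `1` are uniformly bounded. -/
lemma exists_jointLik_le {r : I} (hr : r < 1) (ω : Ω) (K : ℝ) :
    ∃ C : ℝ≥0∞, C ≠ ∞ ∧ ∀ s ≤ r, ∀ x : Fin m → ℝ, (∀ α, |x α| ≤ K) → M.jointLik s ω x ≤ C := by
  have hb : ∀ k : (α : Fin m) × Fin (n α), ∃ Y, ∀ u, |M.info k.1 u ω k.2| ≤ Y := fun k => by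
    obtain ⟨Y, hY⟩ := isCompact_univ.exists_bound_of_continuousOn
      (M.continuous_info k.1 ω k.2).continuousOn
    exact ⟨Y, fun u => hY u (mem_univ u)⟩
  choose Y hY using hb
  -- In each exponent the term −T x²/2 is dropped, x y is bounded by K Y, and 1 − T is bounded below
  -- by 1 − r.
  refine ⟨∏ k : (α : Fin m) × Fin (n α),
    ENNReal.ofReal (Real.exp (K * Y k / (M.vol k.1 k.2 ^ 2 * (1 - r)))),
    ENNReal.prod_ne_top fun _ _ => ENNReal.ofReal_ne_top, fun s hs x hx => ?_⟩
  refine Finset.prod_le_prod' fun k _ => ENNReal.ofReal_le_ofReal ?_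
  have hv := M.vol_pos k.1 k.2
  have hr1 : (0 : ℝ) < 1 - r := sub_pos.2 hr
  have hT : (M.lastTimes s ω k : ℝ) ≤ r := (M.lastActive_le k.1 k.2 s ω).trans hs
  have hT0 : (0 : ℝ) ≤ M.lastTimes s ω k := (M.lastTimes s ω k).2.1
  have hKY : x k.1 * M.infoAt (M.lastTimes s ω) ω k ≤ K * Y k := by
    refine (le_abs_self _).trans ?_
    rw [abs_mul]
    exact mul_le_mul (hx k.1) (hY k _) (abs_nonneg _) ((abs_nonneg _).trans (hx k.1))
  have hKY0 : 0 ≤ K * Y k :=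
    mul_nonneg ((abs_nonneg _).trans (hx k.1)) ((abs_nonneg _).trans (hY k s))
  simp only [gaussH, hv.ne', if_false]
  refine Real.exp_le_exp.2 (div_le_div₀ hKY0 ?_ (by positivity) ?_)
  · have : 0 ≤ (M.lastTimes s ω k : ℝ) * x k.1 ^ 2 / 2 := by positivity
    linarith
  · exact mul_le_mul_of_nonneg_left (by linarith) (by positivity)

lemma measurable_jointLik (t : I) (ω : Ω) : Measurable (M.jointLik t ω) :=
  Measurable.sourceLik (fun k => measurable_pi_apply k.1) measurable_const measurable_const
    measurable_id

variable [IsProbabilityMeasure P]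

/-- Upper semicontinuity from the right of the posterior mass of a bounded set. -/
lemma limsup_posteriorAt_le {t : I} (ht : t < 1) (ω : Ω) {s : ℕ → I} {r : I} (hr : r < 1)
    (hs : ∀ k, t < s k) (hsr : ∀ k, s k ≤ r) (hlim : Tendsto s atTop (𝓝 t))
    {A : Set (Fin m → ℝ)} (hA : MeasurableSet A) {K : ℝ} (hK : ∀ x ∈ A, ∀ α, |x α| ≤ K) :
    limsup (fun k => M.posteriorAt (s k) ω A) atTop ≤ M.posteriorAt t ω A := by
  obtain ⟨C, hC, hle⟩ := M.exists_jointLik_le hr ω K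
  have htr : t ≤ r := (hs 0).le.trans (hsr 0)
  have hN : Tendsto (fun k => ∫⁻ x in A, M.jointLik (s k) ω x ∂(P.map M.vecX)) atTop
      (𝓝 (∫⁻ x in A, M.jointLik t ω x ∂(P.map M.vecX))) := by
    refine tendsto_lintegral_of_dominated_convergence (fun _ => C)
      (fun k => M.measurable_jointLik (s k) ω) (fun k => ?_) ?_
      (Eventually.of_forall fun x => M.tendsto_jointLik ht ω hs hlim x)
    · exact ae_restrict_of_forall_mem hA fun x hx => hle _ (hsr k) x (hK x hx)
    · rw [lintegral_const]
      exact ENNReal.mul_ne_top hC (measure_ne_top _ _)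
  have hNfin : ∫⁻ x in A, M.jointLik t ω x ∂(P.map M.vecX) ≠ ∞ := by
    refine ne_top_of_le_ne_top (ENNReal.mul_ne_top hC (measure_ne_top (P.map M.vecX) A)) ?_
    rw [← setLIntegral_const]
    exact setLIntegral_mono measurable_const fun x hx => hle _ htr x (hK x hx)
  -- The normaliser integrates over unbounded x, where the bound C does not apply; Fatou's lemma
  -- needs no domination, and its direction is the one that bounds the inverse from above.
  have hZ : ∫⁻ x, M.jointLik t ω x ∂(P.map M.vecX) ≤
      liminf (fun k => ∫⁻ x, M.jointLik (s k) ω x ∂(P.map M.vecX)) atTop := by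
    refine le_trans (le_of_eq (lintegral_congr fun x => ?_))
      (lintegral_liminf_le fun k => M.measurable_jointLik (s k) ω)
    exact ((M.tendsto_jointLik ht ω hs hlim x).liminf_eq).symm
  have hZ0 : ∫⁻ x, M.jointLik t ω x ∂(P.map M.vecX) ≠ 0 :=
    lintegral_ne_zero_of_pos (M.measurable_jointLik t ω) (sourceLik_pos _ _)
  have hinv : limsup (fun k => (∫⁻ x, M.jointLik (s k) ω x ∂(P.map M.vecX))⁻¹) atTop ≤
      (∫⁻ x, M.jointLik t ω x ∂(P.map M.vecX))⁻¹ := by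
    refine le_trans (le_of_eq ?_) (ENNReal.inv_le_inv.2 hZ)
    exact (ENNReal.inv_liminf).symm
  simp_rw [posteriorAt, bayesPosterior_apply hA]
  refine (ENNReal.limsup_mul_le' (.inr ?_) (.inl ?_)).trans ?_
  · rw [hN.limsup_eq]
    exact hNfin
  · exact ne_top_of_le_ne_top (ENNReal.inv_ne_top.2 hZ0) hinv
  · rw [hN.limsup_eq]
    gcongr

/-- An event of `augSigma t` agrees, up to a null set, with one of `natSigma (s k)` for every s k >
t, where the Bayes identity is exact. Reverse Fatou, with bound 1, and upper semicontinuity pass to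
the limit. -/
lemma measure_inter_le_lintegral_posteriorAt {t : I} (ht : t < 1) {A : Set (Fin m → ℝ)}
    (hA : MeasurableSet A) {H : Set Ω} (hH : MeasurableSet[M.augSigma t] H) :
    P (M.vecX ⁻¹' A ∩ H) ≤ ∫⁻ ω in H, M.posteriorAt t ω A ∂P := by
  obtain ⟨s, hanti, hs, hlim⟩ := exists_seq_strictAnti_tendsto' ht
  -- Truncation makes the set bounded, as upper semicontinuity requires; it is removed at the end by
  -- monotone exhaustion in K.
  have key : ∀ K : ℕ, P (M.vecX ⁻¹' (A ∩ {x | ∀ α, |x α| ≤ K}) ∩ H) ≤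
      ∫⁻ ω in H, M.posteriorAt t ω A ∂P := fun K => by
    have hB : MeasurableSet (A ∩ {x : Fin m → ℝ | ∀ α, |x α| ≤ K}) := by
      refine hA.inter ?_
      simp only [Set.ofPred_forall]
      exact MeasurableSet.iInter fun α =>
        measurableSet_le (measurable_pi_apply α).abs measurable_const
    have hk : ∀ k, P (M.vecX ⁻¹' (A ∩ {x | ∀ α, |x α| ≤ K}) ∩ H) =
        ∫⁻ ω in H, M.posteriorAt (s k) ω (A ∩ {x | ∀ α, |x α| ≤ K}) ∂P := fun k => by
      have hHk : MeasurableSet[M.complSigma (s k)] H :=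
        (iInf₂_le (s k) (hs k).1 : M.augSigma t ≤ _) _ hH
      obtain ⟨H', hH', hae⟩ := M.exists_natSigma_ae_eq hHk
      rw [measure_congr ((ae_eq_refl _).inter hae), setLIntegral_congr hae]
      exact M.measure_inter_eq_lintegral_posteriorAt (hs k).2 hB hH'
    calc P (M.vecX ⁻¹' (A ∩ {x | ∀ α, |x α| ≤ K}) ∩ H)
        = limsup (fun k => ∫⁻ ω in H,
            M.posteriorAt (s k) ω (A ∩ {x | ∀ α, |x α| ≤ K}) ∂P) atTop := by
          simp_rw [← hk]
          exact (limsup_const _).symm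
      _ ≤ ∫⁻ ω in H, limsup (fun k =>
            M.posteriorAt (s k) ω (A ∩ {x | ∀ α, |x α| ≤ K})) atTop ∂P := by
          refine limsup_lintegral_le (fun _ => 1) (fun k => M.measurable_posteriorAt (s k) hB)
            (fun k => Eventually.of_forall fun ω => bayesPosterior_le_one _) ?_
          rw [lintegral_const, one_mul]
          exact measure_ne_top _ _
      _ ≤ ∫⁻ ω in H, M.posteriorAt t ω A ∂P := by
          refine lintegral_mono fun ω => ?_
          refine (M.limsup_posteriorAt_le ht ω (hs 0).2 (fun k => (hs k).1)
            (fun k => hanti.antitone (Nat.zero_le k)) hlim hB fun x hx => hx.2).trans ?_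
          exact measure_mono inter_subset_left
  have hU : M.vecX ⁻¹' A ∩ H = ⋃ K : ℕ, M.vecX ⁻¹' (A ∩ {x | ∀ α, |x α| ≤ K}) ∩ H := by
    ext ω
    simp only [mem_inter_iff, mem_preimage, mem_iUnion, mem_ofPred_eq]
    constructor
    · rintro ⟨hω, hH⟩
      obtain ⟨K, hK⟩ := exists_nat_ge (∑ α, |M.vecX ω α|)
      exact ⟨K, ⟨hω, fun α => (Finset.single_le_sum (f := fun α => |M.vecX ω α|)
        (fun _ _ => abs_nonneg _) (Finset.mem_univ α)).trans hK⟩, hH⟩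
    · rintro ⟨K, ⟨hω, _⟩, hH⟩
      exact ⟨hω, hH⟩
  have hmono : Monotone fun K : ℕ => M.vecX ⁻¹' (A ∩ {x | ∀ α, |x α| ≤ K}) ∩ H :=
    fun K L hKL ω hω => ⟨⟨hω.1.1, fun α => (hω.1.2 α).trans (Nat.cast_le.2 hKL)⟩, hω.2⟩
  rw [hU, hmono.measure_iUnion]
  exact iSup_le key

/-- The one-sided bounds for H and Hᶜ add up to the identity for the whole space, already known from
`natSigma`. As all masses are finite, neither bound can be strict. -/
theorem measure_inter_eq_lintegral_posteriorAt_augSigma {t : I} (ht : t < 1)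
    {A : Set (Fin m → ℝ)} (hA : MeasurableSet A) {H : Set Ω} (hH : MeasurableSet[M.augSigma t] H) :
    P (M.vecX ⁻¹' A ∩ H) = ∫⁻ ω in H, M.posteriorAt t ω A ∂P := by
  have hHm : MeasurableSet H := M.augSigma_le ht _ hH
  have h1 := M.measure_inter_le_lintegral_posteriorAt ht hA hH
  have h2 := M.measure_inter_le_lintegral_posteriorAt ht hA (MeasurableSet.compl hH)
  have h3 : ∫⁻ ω in H, M.posteriorAt t ω A ∂P + ∫⁻ ω in Hᶜ, M.posteriorAt t ω A ∂P =
      P (M.vecX ⁻¹' A ∩ H) + P (M.vecX ⁻¹' A ∩ Hᶜ) := by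
    have h4 := M.measure_inter_eq_lintegral_posteriorAt ht hA (H := univ)
      (@MeasurableSet.univ _ (M.natSigma t))
    rw [inter_univ, Measure.restrict_univ] at h4
    rw [lintegral_add_compl _ hHm, ← h4, ← Set.sdiff_eq, measure_inter_add_sdiff _ hHm]
  refine le_antisymm h1 ?_
  refine ENNReal.le_of_add_le_add_right (measure_ne_top P (M.vecX ⁻¹' A ∩ Hᶜ)) ?_
  rw [← h3]
  gcongr

end InfoModel

/-! ### Conditional laws from integral identities -/

section CondExp

variable {Ω E : Type*} {𝓗 : MeasurableSpace Ω} [mΩ : MeasurableSpace Ω] [MeasurableSpace E] {P : Measure Ω}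
  [IsProbabilityMeasure P]

lemma real_ae_eq_condExp_of_lintegral (h𝓗 : 𝓗 ≤ mΩ) {Y : Ω → E}
    (hY : Measurable Y) {κ : Ω → Measure E} {A : Set E} (hA : MeasurableSet A)
    (hle : ∀ ω, κ ω A ≤ 1) (hκ : AEStronglyMeasurable[𝓗] (fun ω => (κ ω).real A) P)
    (h : ∀ H, MeasurableSet[𝓗] H → P (Y ⁻¹' A ∩ H) = ∫⁻ ω in H, κ ω A ∂P) :
    (fun ω => (κ ω).real A) =ᵐ[P] P[(Y ⁻¹' A).indicator (fun _ => (1 : ℝ)) | 𝓗] := by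
  have hm : AEStronglyMeasurable (fun ω => (κ ω).real A) P := hκ.mono h𝓗
  have hint : Integrable (fun ω => (κ ω).real A) P := by
    refine Integrable.of_bound hm 1 (Eventually.of_forall fun ω => ?_)
    rw [Real.norm_of_nonneg measureReal_nonneg]
    exact ENNReal.toReal_le_of_le_ofReal zero_le_one (by simpa using hle ω)
  refine ae_eq_condExp_of_forall_setIntegral_eq h𝓗 ((integrable_const 1).indicator (hY hA))
    (fun _ _ _ => hint.integrableOn) (fun H hH _ => ?_) hκ
  have hκ' : AEMeasurable (fun ω => κ ω A) (P.restrict H) := by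
    have h1 : (fun ω => κ ω A) = fun ω => ENNReal.ofReal ((κ ω).real A) := by
      ext ω
      exact (ENNReal.ofReal_toReal (ne_top_of_le_ne_top ENNReal.one_ne_top (hle ω))).symm
    rw [h1]
    exact hm.aemeasurable.ennreal_ofReal.restrict
  simp_rw [measureReal_def]
  rw [integral_toReal hκ' (Eventually.of_forall fun ω => (hle ω).trans_lt ENNReal.one_lt_top),
    ← h H hH, setIntegral_indicator (hY hA), setIntegral_const, smul_eq_mul, mul_one,
    measureReal_def, inter_comm]

lemma IsCondLaw.of_lintegral (h𝓗 : 𝓗 ≤ mΩ) {Y : Ω → E}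
    (hY : Measurable Y) {κ κ' : Ω → Measure E} (hle : ∀ ω A, κ ω A ≤ 1)
    (hκ : ∀ A, MeasurableSet A → AEStronglyMeasurable[𝓗] (fun ω => (κ ω).real A) P)
    (h : ∀ A, MeasurableSet A → ∀ H, MeasurableSet[𝓗] H →
      P (Y ⁻¹' A ∩ H) = ∫⁻ ω in H, κ ω A ∂P)
    (hκ' : ∀ ω, IsProbabilityMeasure (κ' ω)) (hae : κ' =ᵐ[P] κ) : IsCondLaw P 𝓗 Y κ' where
  le := h𝓗
  isProbabilityMeasure := hκ'
  condProb A hA := by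
    refine EventuallyEq.trans ?_ (real_ae_eq_condExp_of_lintegral h𝓗 hY hA (fun ω => hle ω A)
      (hκ A hA) (h A hA))
    filter_upwards [hae] with ω hω
    rw [hω]

omit [IsProbabilityMeasure P] in
-- Intervals with rational endpoints determine a probability measure on ℝ and are countably many, so
-- the null sets depending on A combine into a single one.
lemma ae_eq_of_real_ae_eq {κ κ' : Ω → Measure ℝ} (hκ : ∀ᵐ ω ∂P, IsProbabilityMeasure (κ ω))
    (hκ' : ∀ᵐ ω ∂P, IsProbabilityMeasure (κ' ω))
    (h : ∀ A, MeasurableSet A → (fun ω => (κ ω).real A) =ᵐ[P] fun ω => (κ' ω).real A) :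
    κ =ᵐ[P] κ' := by
  have hall : ∀ᵐ ω ∂P, ∀ a b : ℚ,
      (κ ω).real (Ioo (a : ℝ) b) = (κ' ω).real (Ioo (a : ℝ) b) :=
    ae_all_iff.2 fun a => ae_all_iff.2 fun b => h _ measurableSet_Ioo
  filter_upwards [hκ, hκ', hall] with ω h1 h2 hω
  refine Real.measure_ext_Ioo_rat fun a b => ?_
  exact (measureReal_eq_measureReal_iff (measure_ne_top _ _) (measure_ne_top _ _)).1 (hω a b)

end CondExp

namespace InfoModel

variable {Ω : Type*} [mΩ : MeasurableSpace Ω] {P : Measure Ω} {m : ℕ} {n : Fin m → ℕ} {𝕏 : Set ℝ}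
  (M : InfoModel P m n 𝕏)

/-! ### The main theorem -/

lemma posterior_le_one (α : Fin m) (t : I) (ω : Ω) (A : Set ℝ) : M.posterior α t ω A ≤ 1 :=
  bayesPosterior_le_one (ν := M.law α) (w := fun x => ENNReal.ofReal (M.effWeight α t ω x)) A

variable [IsProbabilityMeasure P]

/-- The posterior of a factor only depends on the effective and complementary observations. -/
lemma measurable_posterior_comap (α : Fin m) (t : I) {A : Set ℝ} (hA : MeasurableSet A) :
    Measurable[MeasurableSpace.comap (M.effCompObs α t) inferInstance]
      fun ω => M.posterior α t ω A := by
  -- The complementary information is observed only at points of 𝕏, which need not be a measurable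
  -- set, so the prior is moved to the subtype.
  let Xs : Ω → 𝕏 := fun ω => ⟨M.X α ω, M.X_mem α ω⟩
  have hXs : Measurable Xs := (M.X_measurable α).subtype_mk
  have hlaw : M.law α = (P.map Xs).map Subtype.val := by
    rw [Measure.map_map measurable_subtype_coe hXs]
    rfl
  have hobs := comap_measurable (m := inferInstance) (M.effCompObs α t)
  have hwm : ∀ ω, Measurable fun x => ENNReal.ofReal (M.effWeight α t ω x) := fun ω =>
    (M.continuous_effWeight α t ω).measurable.ennreal_ofReal
  have hjoint : Measurable[(MeasurableSpace.comap (M.effCompObs α t) inferInstance).prod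
      inferInstance] fun q : Ω × 𝕏 => ENNReal.ofReal (M.effWeight α t q.1 q.2) := by
    refine Measurable.ennreal_ofReal ?_
    -- Evaluation (η, x) ↦ η x need not be jointly measurable on the full function space; continuity
    -- of the weight in x supplies joint measurability.
    refine (measurable_uncurry_of_continuous_of_measurable
      (m := MeasurableSpace.comap (M.effCompObs α t) inferInstance)
      (u := fun (x : 𝕏) ω => M.effWeight α t ω x)
      (fun ω => (M.continuous_effWeight α t ω).comp continuous_subtype_val)
      fun x => ?_).comp measurable_swap
    exact (measurable_const.gaussH (measurable_fst.comp (measurable_fst.comp hobs))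
      measurable_const (measurable_snd.comp (measurable_fst.comp hobs))).mul
      ((measurable_pi_apply x).comp (measurable_snd.comp hobs))
  have heq : ∀ ω, M.posterior α t ω A = bayesPosterior (P.map Xs)
      (fun x : 𝕏 => ENNReal.ofReal (M.effWeight α t ω x)) (Subtype.val ⁻¹' A) := fun ω => by
    have h1 : M.posterior α t ω = bayesPosterior (M.law α)
      fun x => ENNReal.ofReal (M.effWeight α t ω x) := rfl
    rw [h1, bayesPosterior_apply hA, bayesPosterior_apply (measurable_subtype_coe hA), hlaw,
      lintegral_map (hwm ω) measurable_subtype_coe,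
      setLIntegral_map hA (hwm ω) measurable_subtype_coe]
  simp_rw [heq]
  exact measurable_bayesPosterior_apply (w := fun ω (x : 𝕏) =>
    ENNReal.ofReal (M.effWeight α t ω x)) hjoint (measurable_subtype_coe hA)

/-- This is the tower property: the posterior is measurable for the smaller σ-algebra of
`effCompObs`, whose events agree up to null sets with events of `natSigma t`, so the Bayes identity
restricts to it. -/
lemma condDistrib_effCompObs_ae_eq {t : I} (ht : t < 1) (α : Fin m) :
    ∀ᵐ ω ∂P, condDistrib (M.X α) (M.effCompObs α t) P (M.effCompObs α t ω) =
      M.posterior α t ω := by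
  have hobs := M.measurable_effCompObs α t
  refine ae_eq_of_real_ae_eq (Eventually.of_forall fun ω => inferInstance) ?_ fun A hA => ?_
  · filter_upwards [M.posterior_factorizes ht] with ω hω using hω.1 α
  refine (condDistrib_ae_eq_condExp hobs (M.X_measurable α) hA).trans ?_
  refine (real_ae_eq_condExp_of_lintegral hobs.comap_le (M.X_measurable α) hA
    (fun ω => M.posterior_le_one α t ω A)
    (M.measurable_posterior_comap α t hA).ennreal_toReal.stronglyMeasurable.aestronglyMeasurable
    ?_).symm
  rintro _ ⟨S, hS, rfl⟩
  obtain ⟨O, hO, hae⟩ := M.exists_natSigma_measurable_effCompObs α t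
  have hset : M.effCompObs α t ⁻¹' S =ᵐ[P] O ⁻¹' S := by
    filter_upwards [hae] with ω hω
    change (M.effCompObs α t ω ∈ S) = (O ω ∈ S)
    rw [hω]
  have h := M.measure_inter_eq_lintegral_posteriorAt ht
    (A := (fun x : Fin m → ℝ => x α) ⁻¹' A) (measurable_pi_apply α hA) (hO hS)
  rw [measure_congr ((ae_eq_refl _).inter hset), setLIntegral_congr hset]
  refine h.trans (lintegral_congr_ae (ae_restrict_of_ae ?_))
  filter_upwards [M.posterior_apply_ae ht α hA] with ω hω using hω.symm

lemma pi_condDistrib_ae_eq {t : I} (ht : t < 1) :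
    (fun ω => Measure.pi fun α =>
      condDistrib (M.X α) (M.effCompObs α t) P (M.effCompObs α t ω)) =ᵐ[P] M.posteriorAt t := by
  filter_upwards [ae_all_iff.2 fun α => M.condDistrib_effCompObs_ae_eq ht α,
    M.posterior_factorizes ht] with ω h1 h2
  rw [h2.2]
  congr 1
  ext α : 1
  exact h1 α

/-- Substituting f for the volatility makes the conditional law given `effCompObs` a function of the
pair, up to a null set. Events of the pair are also events of `effCompObs`, so it satisfies the
identity that defines conditioning on the pair. -/
lemma condDistrib_effCompPair_ae_eq (t : I) (α : Fin m)
    (h : ∃ f : ℝ × (𝕏 → ℝ) → ℝ, Measurable f ∧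
      M.effVol α t =ᵐ[P] fun ω => f (M.effCompPair α t ω)) :
    ∀ᵐ ω ∂P, condDistrib (M.X α) (M.effCompPair α t) P (M.effCompPair α t ω) =
      condDistrib (M.X α) (M.effCompObs α t) P (M.effCompObs α t ω) := by
  obtain ⟨f, hf, hfae⟩ := h
  have hobs := M.measurable_effCompObs α t
  have hproj : Measurable fun q : (ℝ × ℝ) × (𝕏 → ℝ) => (q.1.1, q.2) := by fun_prop
  have hpair : Measurable (M.effCompPair α t) := hproj.comp hobs
  have hg : Measurable fun q : ℝ × (𝕏 → ℝ) => (((q.1, f q), q.2) : (ℝ × ℝ) × (𝕏 → ℝ)) :=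
    (measurable_fst.prodMk hf).prodMk measurable_snd
  refine ae_eq_of_real_ae_eq (Eventually.of_forall fun ω => inferInstance)
    (Eventually.of_forall fun ω => inferInstance) fun A hA => ?_
  refine (condDistrib_ae_eq_condExp hpair (M.X_measurable α) hA).trans ?_
  refine (real_ae_eq_condExp_of_lintegral hpair.comap_le (M.X_measurable α) hA
    (fun ω => prob_le_one) ⟨fun ω => (condDistrib (M.X α) (M.effCompObs α t) P
      (((M.effCompPair α t ω).1, f (M.effCompPair α t ω)), (M.effCompPair α t ω).2)).real A,
      ?_, ?_⟩ ?_).symm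
  · exact (((Kernel.measurable_coe _ hA).comp
      (hg.comp (comap_measurable (M.effCompPair α t)))).ennreal_toReal).stronglyMeasurable
  · filter_upwards [hfae] with ω hω
    rw [← hω]
    rfl
  · rintro _ ⟨S, hS, rfl⟩
    rw [inter_comm]
    exact (setLIntegral_preimage_condDistrib hobs (M.X_measurable α).aemeasurable hA
      (hproj hS)).symm

end InfoModel

end

theorem mainTheorem10 {Ω : Type*} [MeasurableSpace Ω] (P : Measure Ω) [IsProbabilityMeasure P]
    (m : ℕ) (n : Fin m → ℕ) (𝕏 : Set ℝ) (M : InfoModel P m n 𝕏) (t : I) (ht : t < 1) :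
    -- the conditional law of the vector given the generated filtration (plain, or completed and
    -- made right-continuous) is the product of the factorwise conditional laws
    IsCondLaw P (M.natSigma t) M.vecX
        (fun ω => Measure.pi fun α =>
          condDistrib (M.X α) (M.effCompObs α t) P (M.effCompObs α t ω)) ∧
      IsCondLaw P (M.augSigma t) M.vecX
        (fun ω => Measure.pi fun α =>
          condDistrib (M.X α) (M.effCompObs α t) P (M.effCompObs α t ω)) ∧
      -- each factor has the effective/complementary form
      (∀ α, ∀ᵐ ω ∂P,
        condDistrib (M.X α) (M.effCompObs α t) P (M.effCompObs α t ω) = M.posterior α t ω) ∧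
      -- the volatility parameter may be left out of the conditioning whenever it is determined
      -- by the effective and complementary information
      (∀ α, (∃ f : ℝ × (𝕏 → ℝ) → ℝ, Measurable f ∧
          M.effVol α t =ᵐ[P] fun ω => f (M.effCompPair α t ω)) →
        ∀ᵐ ω ∂P, condDistrib (M.X α) (M.effCompPair α t) P (M.effCompPair α t ω) =
          condDistrib (M.X α) (M.effCompObs α t) P (M.effCompObs α t ω)) := by
  refine ⟨?_, ?_, fun α => M.condDistrib_effCompObs_ae_eq ht α,
    fun α h => M.condDistrib_effCompPair_ae_eq t α h⟩
  · exact IsCondLaw.of_lintegral (M.natSigma_le t) M.measurable_vecX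
      (fun ω A => bayesPosterior_le_one A) (fun A hA => M.aestronglyMeasurable_posteriorAt t hA)
      (fun A hA H hH => M.measure_inter_eq_lintegral_posteriorAt ht hA hH)
      (fun ω => inferInstance) (M.pi_condDistrib_ae_eq ht)
  · exact IsCondLaw.of_lintegral (M.augSigma_le ht) M.measurable_vecX
      (fun ω A => bayesPosterior_le_one A)
      (fun A hA => (M.aestronglyMeasurable_posteriorAt t hA).mono M.natSigma_le_augSigma)
      (fun A hA H hH => M.measure_inter_eq_lintegral_posteriorAt_augSigma ht hA hH)
      (fun ω => inferInstance) (M.pi_condDistrib_ae_eq ht)
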